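/- Let $M$ be a nonempty complete smooth $n$-dimensional Riemannian manifold (without boundary), and let $\varphi : M \hookrightarrow \mathbb{R}^N$ be a smooth isometric embedding (a smooth embedding which pulls the Euclidean metric back to the metric of $M$) whose image lies in an open Euclidean ball of radius $R>0$. Let $\alpha$ be the second fundamental form of $\varphi$ and let $\vec H = \operatorname{tr}\alpha$ be its (unnormalized) mean curvature vector. Let $$\lambda^{*}(M)=\inf\left\{\frac{\int_M |\nabla f|^2}{\int_M f^2} : f\in H_0^1(M)\setminus\{0\}\right\}$$ be the fundamental tone of $M$, where $H_0^1(M)$ is the completion of $C_c^\infty(M)$ for the norm $\left(\int_M f^2+\int_M|\nabla f|^2\right)^{1/2}$. Then $$\sup_M \|\vec H\| \;\ge\; \frac{n}{R}-\lambda^{*}(M)\,\frac{R}{2},$$ where the supremum may be $+\infty$. Consequently, if $n\ge 1$ and $\vec H = n H \eta$ with a function $H$ on $M$ and a field $\eta$ of unit normal vectors along $\varphi$, then $$\sup_M |H| \;\ge\; \frac1R-\lambda^{*}(M)\,\frac{R}{2n}.$$ -/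

import Mathlib

open scoped Manifold ContDiff ENNReal Topology Bundle
open MeasureTheory Filter

noncomputable section

namespace RiemGeom

section Intrinsic

variable (n : ℕ) (M : Type*) [TopologicalSpace M] [ChartedSpace (EuclideanSpace ℝ (Fin n)) M]

/-- A countable family of charts covers a nonempty second countable manifold. -/
theorem exists_chart_cover [Nonempty M] [SecondCountableTopology M] :
    ∃ p : ℕ → M, ⋃ i, (chartAt (EuclideanSpace ℝ (Fin n)) (p i)).source = Set.univ := by
  obtain ⟨s, hs, hU⟩ := TopologicalSpace.countable_cover_nhds
    (fun x : M => chart_source_mem_nhds (EuclideanSpace ℝ (Fin n)) x)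
  have hne : s.Nonempty := by
    by_contra h
    rw [Set.not_nonempty_iff_eq_empty] at h
    subst h
    simp only [Set.mem_empty_iff_false, Set.iUnion_of_empty, Set.iUnion_empty] at hU
    exact Set.empty_ne_univ hU
  obtain ⟨p, rfl⟩ := hs.exists_eq_range hne
  exact ⟨p, by simpa using hU⟩

/-- Centres of a countable family of charts covering the manifold. -/
def chartCenters [Nonempty M] [SecondCountableTopology M] : ℕ → M :=
  (exists_chart_cover n M).choose

variable {M}

/-- The coordinate vector `∂ᵢ` of the chart centred at `p`, at the point with coordinates `y`. -/
def coordVector (p : M) (y : EuclideanSpace ℝ (Fin n)) (i : Fin n) :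
    TangentSpace (𝓡 n) ((extChartAt (𝓡 n) p).symm y) :=
  mfderiv 𝓘(ℝ, EuclideanSpace ℝ (Fin n)) (𝓡 n) (extChartAt (𝓡 n) p).symm y
    (EuclideanSpace.single i (1 : ℝ) : EuclideanSpace ℝ (Fin n))

instance finiteDimensional_tangentSpace (x : M) :
    FiniteDimensional ℝ (TangentSpace (𝓡 n) x) :=
  inferInstanceAs (FiniteDimensional ℝ (EuclideanSpace ℝ (Fin n)))

variable [Bundle.RiemannianBundle (fun x : M => TangentSpace (𝓡 n) x)]

instance completeSpace_tangentSpace (x : M) : CompleteSpace (TangentSpace (𝓡 n) x) :=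
  FiniteDimensional.complete ℝ _

/-- The matrix `gᵢⱼ = ⟨∂ᵢ, ∂ⱼ⟩` of the metric in the chart centred at `p`, at coordinates `y`. -/
def gram (p : M) (y : EuclideanSpace ℝ (Fin n)) : Matrix (Fin n) (Fin n) ℝ :=
  Matrix.of fun i j => inner ℝ (coordVector n p y i) (coordVector n p y j)

/-- The measure `√(det g) dy` of the chart centred at `p`, carried by the domain of that chart. -/
def chartMeasure [MeasurableSpace M] (p : M) : Measure M :=
  ((volume.restrict (extChartAt (𝓡 n) p).target).withDensity
    fun y => ENNReal.ofReal √(gram n p y).det).map (extChartAt (𝓡 n) p).symm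

variable (M) in
/-- The Riemannian volume measure: the manifold is cut into the disjoint pieces
`Uᵢ \ ⋃ j < i, Uⱼ` of a countable cover by chart domains, and each piece is given the measure
`√(det g) dy` of its chart (on overlaps these measures do not depend on the chart). -/
def riemannianVolume [MeasurableSpace M] [Nonempty M] [SecondCountableTopology M] : Measure M :=
  Measure.sum fun i : ℕ => (chartMeasure n (chartCenters n M i)).restrict
    (disjointed
      (fun k => (chartAt (EuclideanSpace ℝ (Fin n)) (chartCenters n M k)).source) i)

/-- The Riemannian gradient: `⟨∇f, v⟩ = df(v)`. -/
def riemannianGradient (f : M → ℝ) (x : M) : TangentSpace (𝓡 n) x :=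
  (InnerProductSpace.toDual ℝ (TangentSpace (𝓡 n) x)).symm (mfderiv (𝓡 n) 𝓘(ℝ, ℝ) f x)

/-- A vector field is measurable, up to null sets, if its components in every chart are. -/
def AEMeasurableField [MeasurableSpace M] (μ : Measure M)
    (X : (x : M) → TangentSpace (𝓡 n) x) : Prop :=
  ∀ p : M, AEStronglyMeasurable
    (fun x => (mfderiv (𝓡 n) 𝓘(ℝ, EuclideanSpace ℝ (Fin n)) (extChartAt (𝓡 n) p) x (X x) :
      EuclideanSpace ℝ (Fin n)))
    (μ.restrict (chartAt (EuclideanSpace ℝ (Fin n)) p).source)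

variable [MeasurableSpace M] [Nonempty M] [SecondCountableTopology M]

/-- `f ∈ H₀¹(M)`, with gradient `X`: the space `H₀¹(M)` is the completion of `C_c^∞(M)` for the norm
`(∫ f² + ∫ |∇f|²)^(1/2)`, that is, there are `u k ∈ C_c^∞(M)` with `u k → f` and `∇(u k) → X` in `L²`
(then `f` and `X` are in `L²`, and `X` is the weak gradient of `f`, hence determined by `f`). -/
structure IsH10 (f : M → ℝ) (X : (x : M) → TangentSpace (𝓡 n) x) : Prop where
  aestronglyMeasurable : AEStronglyMeasurable f (riemannianVolume n M)
  aemeasurableField : AEMeasurableField n (riemannianVolume n M) X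
  exists_approx : ∃ u : ℕ → M → ℝ,
    (∀ k, ContMDiff (𝓡 n) 𝓘(ℝ, ℝ) ∞ (u k) ∧ HasCompactSupport (u k)) ∧
    Tendsto (fun k => ∫⁻ x, ‖u k x - f x‖ₑ ^ 2 ∂(riemannianVolume n M)) atTop (𝓝 0) ∧
    Tendsto (fun k => ∫⁻ x, ‖riemannianGradient n (u k) x - X x‖ₑ ^ 2 ∂(riemannianVolume n M))
      atTop (𝓝 0)

variable (M) in
/-- The fundamental tone: the infimum of `∫ |∇f|² / ∫ f²` over the nonzero `f ∈ H₀¹(M)`. -/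
def fundamentalTone : ℝ≥0∞ :=
  ⨅ (f : M → ℝ) (X : (x : M) → TangentSpace (𝓡 n) x) (_ : IsH10 n f X)
    (_ : ¬ f =ᵐ[riemannianVolume n M] 0),
    (∫⁻ x, ‖X x‖ₑ ^ 2 ∂(riemannianVolume n M)) / (∫⁻ x, ‖f x‖ₑ ^ 2 ∂(riemannianVolume n M))

end Intrinsic

section Extrinsic

variable (n : ℕ) {N : ℕ} {M : Type*} [TopologicalSpace M] [ChartedSpace (EuclideanSpace ℝ (Fin n)) M]

/-- The differential of a map into Euclidean space. -/
def differential (φ : M → EuclideanSpace ℝ (Fin N)) (x : M) :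
    TangentSpace (𝓡 n) x →L[ℝ] EuclideanSpace ℝ (Fin N) :=
  mfderiv (𝓡 n) 𝓘(ℝ, EuclideanSpace ℝ (Fin N)) φ x

/-- The second fundamental form `α(v, w)`: the component normal to `dφ(TₓM)` of the derivative along
`v` of `dφ(W)`, where `W` extends `w` with constant coefficients in the chart centred at `x`. In that
chart this derivative is the second derivative of `φ`. -/
def secondFundamentalForm (φ : M → EuclideanSpace ℝ (Fin N)) (x : M)
    (v w : TangentSpace (𝓡 n) x) : EuclideanSpace ℝ (Fin N) :=
  let e := extChartAt (𝓡 n) x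
  let D : TangentSpace (𝓡 n) x →L[ℝ] EuclideanSpace ℝ (Fin n) :=
    mfderiv (𝓡 n) 𝓘(ℝ, EuclideanSpace ℝ (Fin n)) e x
  (LinearMap.range (differential n φ x).toLinearMap)ᗮ.starProjection
    (fderiv ℝ (fderiv ℝ (φ ∘ e.symm)) (e x) (D v) (D w))

variable [Bundle.RiemannianBundle (fun x : M => TangentSpace (𝓡 n) x)]

/-- The mean curvature vector `tr α`. -/
def meanCurvatureVector (φ : M → EuclideanSpace ℝ (Fin N)) (x : M) : EuclideanSpace ℝ (Fin N) :=
  ∑ i, secondFundamentalForm n φ x (stdOrthonormalBasis ℝ (TangentSpace (𝓡 n) x) i)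
    (stdOrthonormalBasis ℝ (TangentSpace (𝓡 n) x) i)

/-- A smooth embedding that pulls the Euclidean metric back to the given one. -/
structure IsIsometricEmbedding (φ : M → EuclideanSpace ℝ (Fin N)) : Prop where
  isSmoothEmbedding : Manifold.IsSmoothEmbedding (𝓡 n) 𝓘(ℝ, EuclideanSpace ℝ (Fin N)) ∞ φ
  inner_differential : ∀ (x : M) (v w : TangentSpace (𝓡 n) x),
    inner ℝ (differential n φ x v) (differential n φ x w) = inner ℝ v w

end Extrinsic

end RiemGeom

end

/-!
Barta's method for the function `u = R² - ‖φ - c‖²`, which is positive because the image of `φ` lies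
in the ball. Since `Δ(‖φ - c‖² / 2) = n + ⟪φ - c, H⟫`, a bound `‖H‖ ≤ h` with `R h ≤ n` gives
`-Δu ≥ 2 (n - R h) ≥ κ u` with `κ = 2 (n - R h) / R²`. Testing this against `f² / u` and completing a
square yields `∫ |∇f|² ≥ κ ∫ f²` for every test function `f`, hence for all of `H₀¹`, so the
fundamental tone is at least `κ`; solved for `h` this is the claim.

The Laplacian enters only through the first variation formula
`∫ ⟨∇g, (φ - c)ᵀ⟩ + g (n + ⟪φ - c, H⟫) = 0` for smooth compactly supported `g`
(`integral_variationIntegrand`), which a partition of unity reduces to `g` supported in one chart.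
There the metric is `A†A` with `A` the derivative of `φ` in coordinates, the tangential part of
`w = φ - c` is `Z = (A†A)⁻¹ A† w`, and the integrand times the density `J = √det (A†A)` is the
Euclidean divergence of `J g Z` (`divergence_tangentPart`). This is obtained by differentiating
`A†A Z = A† w`, using Jacobi's formula for the derivative of `J` (`fderiv_det`) and the symmetry of
the second derivative of `φ`. That curvature and volume, defined with particular charts, may be
computed in an arbitrary chart is `meanCurvatureVector_eq` (a change of coordinates alters second
derivatives tangentially) and `riemannianVolume_restrict` (the change of variables formula).

`barta_pointwise` completes the square, `barta_lintegral` integrates it, and `le_fundamentalTone`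
passes to `H₀¹`.
-/

noncomputable section

namespace RiemGeom

set_option linter.unusedSectionVars false

/-! ### Gram operators and the divergence of the tangential position field -/

section Flat

open ContinuousLinearMap

variable {E F : Type*} [NormedAddCommGroup E] [InnerProductSpace ℝ E] [FiniteDimensional ℝ E]
  [CompleteSpace E] [NormedAddCommGroup F] [InnerProductSpace ℝ F] [CompleteSpace F]

theorem contDiff_det : ContDiff ℝ ∞ (fun T : E →L[ℝ] E => T.det) := by
  let b := Module.finBasis ℝ E
  have h : (fun T : E →L[ℝ] E => T.det) = fun T : E →L[ℝ] E =>
      ∑ σ : Equiv.Perm (Fin (Module.finrank ℝ E)),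
        (Equiv.Perm.sign σ : ℤ) • ∏ i, LinearMap.toMatrix b b (T : E →ₗ[ℝ] E) (σ i) i := by
    funext T
    rw [ContinuousLinearMap.det, ← LinearMap.det_toMatrix b, Matrix.det_apply]
    rfl
  rw [h]
  have hent : ∀ i j, ContDiff ℝ ∞
      fun T : E →L[ℝ] E => LinearMap.toMatrix b b (T : E →ₗ[ℝ] E) i j := by
    intro i j
    let l : (E →L[ℝ] E) →ₗ[ℝ] ℝ :=
      { toFun := fun T => LinearMap.toMatrix b b (T : E →ₗ[ℝ] E) i j
        map_add' := by intro T T'; simp [LinearMap.toMatrix_apply]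
        map_smul' := by intro c T; simp [LinearMap.toMatrix_apply] }
    exact (LinearMap.toContinuousLinearMap l).contDiff
  refine ContDiff.sum fun σ _ => ?_
  simp only [zsmul_eq_mul]
  exact contDiff_const.mul (contDiff_prod fun i _ => hent (σ i) i)

/-- Jacobi's formula for the derivative of the determinant at an invertible operator. -/
theorem fderiv_det {S : E →L[ℝ] E} (hS : IsUnit S) (B : E →L[ℝ] E) :
    fderiv ℝ (fun T : E →L[ℝ] E => T.det) S B
      = S.det * LinearMap.trace ℝ E (Ring.inverse S ∘L B : E →L[ℝ] E) := by
  let b := Module.finBasis ℝ E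
  set C : E →L[ℝ] E := Ring.inverse S ∘L B with hC
  have hSC : S * C = B := by
    rw [hC, ← ContinuousLinearMap.mul_def, ← mul_assoc, Ring.mul_inverse_cancel _ hS, one_mul]
  have hcurve : HasDerivAt (fun t : ℝ => S + t • B) B 0 := by
    simpa using ((hasDerivAt_id (0 : ℝ)).smul_const B).const_add S
  have h0 : S + (0 : ℝ) • B = S := by simp
  have h1 : HasDerivAt (fun t : ℝ => (S + t • B).det)
      (fderiv ℝ (fun T : E →L[ℝ] E => T.det) S B) 0 := by
    have := ((contDiff_det (E := E)).differentiable (by simp)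
      (S + (0 : ℝ) • B)).hasFDerivAt.comp_hasDerivAt (0 : ℝ) hcurve
    rwa [h0] at this
  set M := LinearMap.toMatrix b b (C : E →ₗ[ℝ] E) with hM
  obtain ⟨p, hp⟩ : ∃ p : Polynomial ℝ, ∀ t : ℝ,
      (S + t • B).det = S.det * (1 + M.trace * t + p.eval t * t ^ 2) := by
    refine ⟨(1 + (Polynomial.X : Polynomial ℝ) •
      M.map (Polynomial.C : ℝ →+* Polynomial ℝ)).det.divX.divX, fun t => ?_⟩
    rw [← Matrix.det_one_add_smul]
    have : S + t • B = S * (1 + t • C) := by rw [mul_add, mul_one, mul_smul_comm, hSC]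
    rw [this, ContinuousLinearMap.det, ContinuousLinearMap.toLinearMap_mul, map_mul]
    congr 1
    rw [← LinearMap.det_toMatrix b]
    congr 1
    ext i j
    simp [hM, LinearMap.toMatrix_apply, Matrix.one_apply, Finsupp.single_apply, eq_comm]
  -- Along the line `S + t B = S (1 + t S⁻¹B)` the determinant has linear coefficient `tr (S⁻¹B)`.
  have h2 : HasDerivAt (fun t : ℝ => (S + t • B).det) (S.det * M.trace) 0 := by
    simp_rw [hp]
    have hq : HasDerivAt (fun t : ℝ => p.eval t * t ^ 2) 0 0 := by
      simpa using (p.hasDerivAt 0).fun_mul ((hasDerivAt_id' (0 : ℝ)).fun_pow 2)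
    have hl : HasDerivAt (fun t : ℝ => 1 + M.trace * t) M.trace 0 := by
      simpa using ((hasDerivAt_id' (0 : ℝ)).const_mul M.trace).const_add 1
    simpa using (hl.fun_add hq).const_mul S.det
  rw [h1.unique h2, hM, LinearMap.trace_eq_matrix_trace ℝ b]

/-- The Gram operator `A†A` of a linear map `A`, representing the form `⟪A u, A v⟫`. -/
def gramOp (A : E →L[ℝ] F) : E →L[ℝ] E := adjoint A ∘L A

theorem inner_gramOp (A : E →L[ℝ] F) (u v : E) : inner ℝ (gramOp A u) v = inner ℝ (A u) (A v) := by
  rw [gramOp, comp_apply, adjoint_inner_left]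

theorem inner_gramOp_right (A : E →L[ℝ] F) (u v : E) :
    inner ℝ u (gramOp A v) = inner ℝ (A u) (A v) := by
  rw [gramOp, comp_apply, adjoint_inner_right]

theorem isUnit_gramOp {A : E →L[ℝ] F} (hA : Function.Injective A) : IsUnit (gramOp A) := by
  rw [ContinuousLinearMap.isUnit_iff_bijective]
  have hinj : Function.Injective (gramOp A) := by
    rw [injective_iff_map_eq_zero]
    intro v hv
    have : inner ℝ (A v) (A v) = 0 := by rw [← inner_gramOp, hv, inner_zero_left]
    exact (injective_iff_map_eq_zero A).1 hA v (inner_self_eq_zero.1 this)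
  exact ⟨hinj, (LinearMap.injective_iff_surjective (f := (gramOp A : E →ₗ[ℝ] E))).1 hinj⟩

theorem gramOp_inverse_apply {A : E →L[ℝ] F} (hA : Function.Injective A) (v : E) :
    gramOp A (Ring.inverse (gramOp A) v) = v := by
  simpa using congrArg (fun T : E →L[ℝ] E => T v) (Ring.mul_inverse_cancel _ (isUnit_gramOp hA))

theorem inverse_gramOp_apply {A : E →L[ℝ] F} (hA : Function.Injective A) (v : E) :
    Ring.inverse (gramOp A) (gramOp A v) = v := by
  simpa using congrArg (fun T : E →L[ℝ] E => T v) (Ring.inverse_mul_cancel _ (isUnit_gramOp hA))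

theorem inner_inverse_gramOp {A : E →L[ℝ] F} (hA : Function.Injective A) (u v : E) :
    inner ℝ (Ring.inverse (gramOp A) u) v = inner ℝ u (Ring.inverse (gramOp A) v) := by
  conv_lhs => rw [← gramOp_inverse_apply hA v]
  conv_rhs => rw [← gramOp_inverse_apply hA u]
  rw [inner_gramOp_right, inner_gramOp]

theorem det_gramOp {ι : Type*} [Fintype ι] [DecidableEq ι] (b : OrthonormalBasis ι ℝ E)
    (A : E →L[ℝ] F) : (gramOp A).det = (Matrix.gram ℝ fun i => A (b i)).det := by
  rw [ContinuousLinearMap.det, ← LinearMap.det_toMatrix b.toBasis]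
  congr 1
  ext i j
  simp only [LinearMap.toMatrix_apply, OrthonormalBasis.coe_toBasis,
    OrthonormalBasis.coe_toBasis_repr_apply, OrthonormalBasis.repr_apply_apply, Matrix.gram_apply]
  exact inner_gramOp_right A (b i) (b j)

theorem det_gramOp_pos {A : E →L[ℝ] F} (hA : Function.Injective A) : 0 < (gramOp A).det := by
  let b := stdOrthonormalBasis ℝ E
  rw [det_gramOp b]
  refine Matrix.PosDef.det_pos (Matrix.posDef_gram_of_linearIndependent ?_)
  simpa [Function.comp_def] using
    b.toBasis.linearIndependent.map' (A : E →ₗ[ℝ] F) (LinearMap.ker_eq_bot.2 hA)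

/-- The volume density `√det (A†A)`. -/
def volDensity (A : E →L[ℝ] F) : ℝ := √(gramOp A).det

theorem volDensity_pos {A : E →L[ℝ] F} (hA : Function.Injective A) : 0 < volDensity A :=
  Real.sqrt_pos.2 (det_gramOp_pos hA)

/-- The vector `Z` for which `A Z` is the orthogonal projection of `w` to the range of the injective
map `A`. For other `A` the value is junk, as `Ring.inverse` then vanishes. -/
def tangentPart (A : E →L[ℝ] F) (w : F) : E := Ring.inverse (gramOp A) (adjoint A w)

theorem gramOp_tangentPart {A : E →L[ℝ] F} (hA : Function.Injective A) (w : F) :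
    gramOp A (tangentPart A w) = adjoint A w := gramOp_inverse_apply hA _

theorem inner_tangentPart {A : E →L[ℝ] F} (hA : Function.Injective A) (w : F) (v : E) :
    inner ℝ (A (tangentPart A w)) (A v) = inner ℝ w (A v) := by
  rw [← inner_gramOp, gramOp_tangentPart hA, adjoint_inner_left]

/-- The trace of the bilinear map `A'` for the metric `⟪A u, A v⟫`, computed in a basis that is
orthonormal for the ambient inner product. -/
def metricTrace {ι : Type*} [Fintype ι] (b : OrthonormalBasis ι ℝ E) (A : E →L[ℝ] F)
    (A' : E →L[ℝ] E →L[ℝ] F) : F :=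
  ∑ i, A' (b i) (Ring.inverse (gramOp A) (b i))

/-- The metric trace may be computed in any basis `c` that is orthonormal for `⟪A u, A v⟫`. -/
theorem metricTrace_eq_sum {ι κ : Type*} [Fintype ι] [Fintype κ] (b : OrthonormalBasis ι ℝ E)
    {A : E →L[ℝ] F} (hA : Function.Injective A) (A' : E →L[ℝ] E →L[ℝ] F) (c : κ → E)
    (hc : ∀ v, ∑ k, inner ℝ (A (c k)) (A v) • c k = v) :
    metricTrace b A A' = ∑ k, A' (c k) (c k) := by
  have h1 : ∀ i, Ring.inverse (gramOp A) (b i) = ∑ k, inner ℝ (b i) (c k) • c k := by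
    intro i
    conv_lhs => rw [← hc (Ring.inverse (gramOp A) (b i))]
    refine Finset.sum_congr rfl fun k _ => ?_
    rw [real_inner_comm, ← inner_gramOp, gramOp_inverse_apply hA]
  simp only [metricTrace, h1, map_sum, map_smul]
  rw [Finset.sum_comm]
  refine Finset.sum_congr rfl fun k _ => ?_
  simpa [sum_apply] using congrArg (fun v => A' v (c k)) (b.sum_repr' (c k))

theorem trace_inverse_comp_adjoint {A : E →L[ℝ] F} (hA : Function.Injective A) (B : E →L[ℝ] E) :
    LinearMap.trace ℝ E (Ring.inverse (gramOp A) ∘L adjoint B : E →L[ℝ] E)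
      = LinearMap.trace ℝ E (Ring.inverse (gramOp A) ∘L B : E →L[ℝ] E) := by
  have h := LinearMap.trace_mul_comm ℝ
    ((Ring.inverse (gramOp A) : E →L[ℝ] E) : E →ₗ[ℝ] E) (B : E →ₗ[ℝ] E)
  let b := stdOrthonormalBasis ℝ E
  refine Eq.trans ?_ h.symm
  rw [LinearMap.trace_eq_sum_inner _ b, LinearMap.trace_eq_sum_inner _ b]
  refine Finset.sum_congr rfl fun i _ => ?_
  change inner ℝ (b i) (Ring.inverse (gramOp A) (adjoint B (b i)))
    = inner ℝ (b i) (B (Ring.inverse (gramOp A) (b i)))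
  rw [← inner_inverse_gramOp hA, adjoint_inner_right, real_inner_comm]

/-- The adjoint as a map that is linear over `ℝ` itself rather than conjugate-linear. -/
def adjointL : (E →L[ℝ] F) →L[ℝ] (F →L[ℝ] E) :=
  LinearMap.mkContinuous
    { toFun := fun A => adjoint A
      map_add' := fun A B => map_add _ A B
      map_smul' := fun c A => by simp } 1 (fun A => by simp)

theorem adjointL_apply (A : E →L[ℝ] F) : adjointL A = adjoint A := rfl

theorem hasFDerivAt_gramOp {A : E → E →L[ℝ] F} {A' : E →L[ℝ] E →L[ℝ] F} {y : E}
    (hA : HasFDerivAt A A' y) :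
    ∃ S' : E →L[ℝ] E →L[ℝ] E, HasFDerivAt (fun z => gramOp (A z)) S' y ∧
      ∀ v, S' v = adjoint (A' v) ∘L A y + adjoint (A y) ∘L A' v := by
  refine ⟨_, ((adjointL.hasFDerivAt (x := A y)).comp y hA).clm_comp hA, fun v => ?_⟩
  ext u
  simp [adjointL_apply, add_comm]

theorem hasFDerivAt_volDensity {A : E → E →L[ℝ] F} {A' : E →L[ℝ] E →L[ℝ] F} {y : E}
    (hA : HasFDerivAt A A' y) (hinj : Function.Injective (A y)) :
    ∃ J' : E →L[ℝ] ℝ, HasFDerivAt (fun z => volDensity (A z)) J' y ∧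
      ∀ v, J' v = volDensity (A y) * LinearMap.trace ℝ E
        (Ring.inverse (gramOp (A y)) ∘L (adjoint (A y) ∘L A' v) : E →L[ℝ] E) := by
  obtain ⟨S', hS', hS'v⟩ := hasFDerivAt_gramOp hA
  have hd : HasFDerivAt (fun T : E →L[ℝ] E => T.det)
      (fderiv ℝ (fun T : E →L[ℝ] E => T.det) (gramOp (A y))) (gramOp (A y)) :=
    ((contDiff_det (E := E)).differentiable (by simp) (gramOp (A y))).hasFDerivAt
  have hdet : HasFDerivAt (fun z => (gramOp (A z)).det)
      (fderiv ℝ (fun T : E →L[ℝ] E => T.det) (gramOp (A y)) ∘L S') y :=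
    HasFDerivAt.comp (g := fun T : E →L[ℝ] E => T.det) y hd hS'
  refine ⟨_, hdet.sqrt (det_gramOp_pos hinj).ne', fun v => ?_⟩
  have htr : LinearMap.trace ℝ E (Ring.inverse (gramOp (A y)) ∘L S' v : E →L[ℝ] E)
      = 2 * LinearMap.trace ℝ E
        (Ring.inverse (gramOp (A y)) ∘L (adjoint (A y) ∘L A' v) : E →L[ℝ] E) := by
    have hadj : adjoint (adjoint (A y) ∘L A' v) = adjoint (A' v) ∘L A y := by
      rw [adjoint_comp, adjoint_adjoint]
    rw [hS'v, comp_add, toLinearMap_add, map_add, ← hadj,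
      trace_inverse_comp_adjoint hinj, two_mul]
  have hpos := det_gramOp_pos hinj
  rw [smul_apply, comp_apply, fderiv_det (isUnit_gramOp hinj), htr, volDensity, smul_eq_mul]
  have hsq := Real.mul_self_sqrt hpos.le
  have hne := (Real.sqrt_pos.2 hpos).ne'
  field_simp
  rw [pow_two, hsq]

theorem differentiableAt_inverse_gramOp {A : E → E →L[ℝ] F} {A' : E →L[ℝ] E →L[ℝ] F} {y : E}
    (hA : HasFDerivAt A A' y) (hinj : Function.Injective (A y)) :
    DifferentiableAt ℝ (fun z => Ring.inverse (gramOp (A z))) y := by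
  obtain ⟨S', hS', -⟩ := hasFDerivAt_gramOp hA
  obtain ⟨u, hu⟩ := isUnit_gramOp hinj
  have h := contDiffAt_ringInverse ℝ (n := 1) u
  rw [hu] at h
  exact (h.differentiableAt (by simp)).comp y hS'.differentiableAt

/-- Divergence of the tangential part of the position vector in flat coordinates. If `A` is the
differential of an immersion `w`, differentiating `(A†A) Z = A† w` gives `DZ`; its trace cancels,
by Jacobi's formula and the symmetry of the second derivative `A'`, against the derivative of the
volume density, and what is left is the dimension plus a normal term. -/
theorem divergence_tangentPart {ι : Type*} [Fintype ι] (b : OrthonormalBasis ι ℝ E)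
    {A : E → E →L[ℝ] F} {A' : E →L[ℝ] E →L[ℝ] F} {y : E} (hA : HasFDerivAt A A' y)
    (hsymm : ∀ u v, A' u v = A' v u) {w : E → F} (hw : HasFDerivAt w (A y) y)
    (hinj : ∀ᶠ z in 𝓝 y, Function.Injective (A z)) {g : E → ℝ} {g' : E →L[ℝ] ℝ}
    (hg : HasFDerivAt g g' y) :
    ∃ W' : E →L[ℝ] E,
      HasFDerivAt (fun z => (volDensity (A z) * g z) • tangentPart (A z) (w z)) W' y ∧
      ∑ i, inner ℝ (b i) (W' (b i)) = volDensity (A y) * (g' (tangentPart (A y) (w y)) +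
        g y * (Fintype.card ι +
          inner ℝ (metricTrace b (A y) A') (w y - A y (tangentPart (A y) (w y))))) := by
  have hiy : Function.Injective (A y) := hinj.self_of_nhds
  obtain ⟨J', hJ', hJ'v⟩ := hasFDerivAt_volDensity hA hiy
  obtain ⟨S', hS', hS'v⟩ := hasFDerivAt_gramOp hA
  have hadj : HasFDerivAt (fun z => adjoint (A z)) 
      ((adjointL : (E →L[ℝ] F) →L[ℝ] _) ∘L A') y :=
    ((adjointL : (E →L[ℝ] F) →L[ℝ] _).hasFDerivAt (x := A y)).comp y hA
  obtain ⟨Z', hZ'⟩ : ∃ Z' : E →L[ℝ] E, HasFDerivAt (fun z => tangentPart (A z) (w z)) Z' y :=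
    ⟨_, ((differentiableAt_inverse_gramOp hA hiy).clm_apply
      (hadj.clm_apply hw).differentiableAt).hasFDerivAt⟩
  set Z := tangentPart (A y) (w y) with hZ
  set S := gramOp (A y) with hS
  set ν := w y - A y Z with hν
  -- Differentiate `(A†A) Z = A† w` and solve for `DZ`.
  have hZ'v : ∀ v, Z' v = Ring.inverse S (adjoint (A' v) ν) + v
      - Ring.inverse S (adjoint (A y) (A' v Z)) := by
    intro v
    have h1 : HasFDerivAt (fun z => gramOp (A z) (tangentPart (A z) (w z))) _ y :=
      hS'.clm_apply hZ'
    have h2 : HasFDerivAt (fun z => adjoint (A z) (w z)) _ y := hadj.clm_apply hw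
    have h3 : (fun z => gramOp (A z) (tangentPart (A z) (w z)))
        =ᶠ[𝓝 y] fun z => adjoint (A z) (w z) := by
      filter_upwards [hinj] with z hz using gramOp_tangentPart hz _
    have h4 := congrArg (fun T : E →L[ℝ] E => T v) ((h1.congr_of_eventuallyEq h3.symm).unique h2)
    simp only [add_apply, comp_apply, flip_apply, hS'v, adjointL_apply, ← hZ, ← hS] at h4
    have h5 : S (Z' v) = adjoint (A' v) ν + S v - adjoint (A y) (A' v Z) := by
      rw [hν, map_sub]
      have : S v = adjoint (A y) (A y v) := rfl
      rw [this, eq_sub_iff_add_eq]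
      rw [← sub_eq_zero] at h4 ⊢
      rw [← h4]
      abel
    rw [← inverse_gramOp_apply hiy (Z' v), ← hS, h5, map_sub, map_add, hS, inverse_gramOp_apply hiy]
  refine ⟨_, (hJ'.mul hg).smul hZ', ?_⟩
  have htr : J' Z = volDensity (A y)
      * ∑ i, inner ℝ (b i) (Ring.inverse S (adjoint (A y) (A' (b i) Z))) := by
    rw [hJ'v, LinearMap.trace_eq_sum_inner _ b]
    congr 1
    refine Finset.sum_congr rfl fun i _ => ?_
    rw [hsymm (b i) Z]
    rfl
  have hH : inner ℝ (metricTrace b (A y) A') ν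
      = ∑ i, inner ℝ (b i) (Ring.inverse S (adjoint (A' (b i)) ν)) := by
    rw [metricTrace, sum_inner]
    refine Finset.sum_congr rfl fun i _ => ?_
    rw [← adjoint_inner_right, hS, inner_inverse_gramOp hiy]
  have hgr : ∀ l : E →L[ℝ] ℝ, ∑ i, inner ℝ (b i) (l (b i) • Z) = l Z := by
    intro l
    conv_rhs => rw [← b.sum_repr' Z]
    simp [inner_smul_right, mul_comm]
  have hn : ∑ i, inner ℝ (b i) (b i) = (Fintype.card ι : ℝ) := by simp
  -- The derivative of `(J g) • Z` by the product rule, with `DZ` inserted.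
  have key : ∀ i, inner ℝ (b i) (((volDensity (A y) * g y) • Z'
      + (volDensity (A y) • g' + g y • J').smulRight Z) (b i))
      = volDensity (A y) * g y * (inner ℝ (b i) (Ring.inverse S (adjoint (A' (b i)) ν))
          + inner ℝ (b i) (b i) - inner ℝ (b i) (Ring.inverse S (adjoint (A y) (A' (b i) Z))))
        + inner ℝ (b i) ((volDensity (A y) • g' + g y • J') (b i) • Z) := by
    intro i
    rw [add_apply, smul_apply, smulRight_apply, hZ'v, inner_add_right, inner_smul_right,
      inner_sub_right, inner_add_right]
  refine (Finset.sum_congr rfl fun i _ => key i).trans ?_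
  rw [Finset.sum_add_distrib, hgr, ← Finset.mul_sum, Finset.sum_sub_distrib,
    Finset.sum_add_distrib, hn, ← hH, add_apply, smul_apply, smul_apply, htr]
  simp only [smul_eq_mul]
  ring

end Flat

/-! ### The divergence theorem in a coordinate domain -/

section FlatIntegral

open ContinuousLinearMap

variable {E F : Type*} [NormedAddCommGroup E] [InnerProductSpace ℝ E] [FiniteDimensional ℝ E]
  [CompleteSpace E] [NormedAddCommGroup F] [InnerProductSpace ℝ F] [CompleteSpace F]

theorem contDiffAt_gramOp {A : E → E →L[ℝ] F} {y : E} (hA : ContDiffAt ℝ 1 A y) :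
    ContDiffAt ℝ 1 (fun z => gramOp (A z)) y :=
  ((adjointL : (E →L[ℝ] F) →L[ℝ] _).contDiff.contDiffAt.comp y hA).clm_comp hA

theorem contDiffAt_volDensity {A : E → E →L[ℝ] F} {y : E} (hA : ContDiffAt ℝ 1 A y)
    (hinj : Function.Injective (A y)) : ContDiffAt ℝ 1 (fun z => volDensity (A z)) y :=
  ContDiffAt.sqrt (ContDiffAt.comp (g := fun T : E →L[ℝ] E => T.det) y
    ((contDiff_det (E := E)).of_le (by simp)).contDiffAt (contDiffAt_gramOp hA))
    (det_gramOp_pos hinj).ne'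

theorem contDiffAt_tangentPart {A : E → E →L[ℝ] F} {w : E → F} {y : E} (hA : ContDiffAt ℝ 1 A y)
    (hw : ContDiffAt ℝ 1 w y) (hinj : Function.Injective (A y)) :
    ContDiffAt ℝ 1 (fun z => tangentPart (A z) (w z)) y := by
  obtain ⟨u, hu⟩ := isUnit_gramOp hinj
  have h := contDiffAt_ringInverse ℝ (n := 1) u
  rw [hu] at h
  exact (ContDiffAt.comp (g := Ring.inverse) y h (contDiffAt_gramOp hA)).clm_apply
    (((adjointL : (E →L[ℝ] F) →L[ℝ] _).contDiff.contDiffAt.comp y hA).clm_apply hw)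

variable [MeasurableSpace E] [BorelSpace E] {ι : Type*} [Fintype ι] (b : OrthonormalBasis ι ℝ E)

/-- The divergence theorem for compactly supported fields on a Euclidean space. -/
theorem integral_divergence_eq_zero {W : E → E} (hW : ContDiff ℝ 1 W) (hc : HasCompactSupport W) :
    Continuous (fun y => ∑ i, inner ℝ (b i) (fderiv ℝ W y (b i))) ∧
    Integrable (fun y => ∑ i, inner ℝ (b i) (fderiv ℝ W y (b i))) ∧
    ∫ y, ∑ i, inner ℝ (b i) (fderiv ℝ W y (b i)) = 0 := by
  have hd : Continuous (fderiv ℝ W) := hW.continuous_fderiv (by simp)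
  have hci : ∀ i, Continuous fun y => inner ℝ (b i) (fderiv ℝ W y (b i)) := fun i =>
    continuous_const.inner (hd.clm_apply continuous_const)
  have hsupp : ∀ i, HasCompactSupport fun y => inner ℝ (b i) (fderiv ℝ W y (b i)) := fun i =>
    (hc.fderiv (𝕜 := ℝ)).comp_left (g := fun T : E →L[ℝ] E => inner ℝ (b i) (T (b i))) (by simp)
  have hint : ∀ i, Integrable fun y => inner ℝ (b i) (fderiv ℝ W y (b i)) := fun i =>
    (hci i).integrable_of_hasCompactSupport (hsupp i)
  refine ⟨continuous_finsetSum _ fun i _ => hci i, integrable_finsetSum _ fun i _ => hint i, ?_⟩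
  rw [integral_finsetSum _ fun i _ => hint i]
  refine Finset.sum_eq_zero fun i _ => ?_
  have hWd : Differentiable ℝ W := hW.differentiable (by simp)
  have hfd : ∀ y, fderiv ℝ (fun y => inner ℝ (b i) (W y)) y (b i)
      = inner ℝ (b i) (fderiv ℝ W y (b i)) := by
    intro y
    rw [fderiv_inner_apply ℝ (by fun_prop) (hWd y)]
    simp
  -- Integration by parts of each component against the constant function `1`.
  have h := integral_mul_fderiv_eq_neg_fderiv_mul_of_integrable (μ := (volume : Measure E))
    (f := fun _ => (1 : ℝ)) (g := fun y => inner ℝ (b i) (W y)) (v := b i)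
    (by simp) (by simpa [hfd] using hint i)
    (by
      simp only [one_mul]
      exact (continuous_const.inner hW.continuous).integrable_of_hasCompactSupport
        (hc.comp_left (g := fun v : E => inner ℝ (b i) v) (by simp)))
    (fun _ _ => by fun_prop)
    (fun y _ => DifferentiableAt.inner ℝ (by fun_prop) (hWd y))
  simpa [hfd] using h

/-- The first variation formula for the field `g • (ψ - c)` in a coordinate domain `U` of the
immersion `ψ`, where `g` vanishes on `U` off a compact subset of `U`. -/
theorem flat_first_variation {U K : Set E} (hU : IsOpen U) (hK : IsCompact K) (hKU : K ⊆ U)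
    {ψ : E → F} (hψ : ContDiffOn ℝ ∞ ψ U) (hinj : ∀ y ∈ U, Function.Injective (fderiv ℝ ψ y))
    {g : E → ℝ} (hg : ContDiffOn ℝ 1 g U) (hgK : ∀ y ∈ U, y ∉ K → g y = 0) (c : F)
    {f : E → ℝ} (hf : ∀ y ∈ U, f y = fderiv ℝ g y (tangentPart (fderiv ℝ ψ y) (ψ y - c)) +
      g y * (Fintype.card ι + inner ℝ (metricTrace b (fderiv ℝ ψ y) (fderiv ℝ (fderiv ℝ ψ) y))
        (ψ y - c - fderiv ℝ ψ y (tangentPart (fderiv ℝ ψ y) (ψ y - c))))) :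
    ContinuousOn f U ∧ IntegrableOn (fun y => volDensity (fderiv ℝ ψ y) * f y) U ∧
      ∫ y in U, volDensity (fderiv ℝ ψ y) * f y = 0 := by
  have hψat : ∀ y ∈ U, ContDiffAt ℝ ∞ ψ y := fun y hy => hψ.contDiffAt (hU.mem_nhds hy)
  have hA1 : ∀ y ∈ U, ContDiffAt ℝ 1 (fderiv ℝ ψ) y := fun y hy =>
    (hψat y hy).fderiv_right (m := 1) (by norm_cast)
  have hw1 : ∀ y ∈ U, ContDiffAt ℝ 1 (fun z => ψ z - c) y := fun y hy =>
    ((hψat y hy).of_le (by simp)).sub contDiffAt_const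
  set W₀ : E → E := fun z => (volDensity (fderiv ℝ ψ z) * g z) •
    tangentPart (fderiv ℝ ψ z) (ψ z - c) with hW₀
  have hW₀c : ∀ y ∈ U, ContDiffAt ℝ 1 W₀ y := fun y hy =>
    ((contDiffAt_volDensity (hA1 y hy) (hinj y hy)).mul (hg.contDiffAt (hU.mem_nhds hy))).smul
      (contDiffAt_tangentPart (hA1 y hy) (hw1 y hy) (hinj y hy))
  -- Off `U` nothing is known about `ψ` and `g`, so the field is extended by zero.
  set W : E → E := U.indicator W₀ with hW
  have hWz : ∀ y, y ∉ K → W y = 0 := by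
    intro y hy
    by_cases hyU : y ∈ U
    · rw [hW, Set.indicator_of_mem hyU, hW₀]
      simp [hgK y hyU hy]
    · rw [hW, Set.indicator_of_notMem hyU]
  have hWeq : ∀ y ∈ U, W =ᶠ[𝓝 y] W₀ := fun y hy => by
    filter_upwards [hU.mem_nhds hy] with z hz using Set.indicator_of_mem hz _
  have hWeq0 : ∀ y, y ∉ U → W =ᶠ[𝓝 y] fun _ => 0 := fun y hy => by
    filter_upwards [hK.isClosed.isOpen_compl.mem_nhds fun h => hy (hKU h)] with z hz
      using hWz z hz
  have hWc : ContDiff ℝ 1 W := by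
    rw [contDiff_iff_contDiffAt]
    intro y
    by_cases hy : y ∈ U
    · exact (hW₀c y hy).congr_of_eventuallyEq (hWeq y hy)
    · exact contDiffAt_const.congr_of_eventuallyEq (hWeq0 y hy)
  have hWs : HasCompactSupport W := HasCompactSupport.intro hK hWz
  obtain ⟨hcont, hint, hzero⟩ := integral_divergence_eq_zero b hWc hWs
  have hdiv : ∀ y ∈ U, ∑ i, inner ℝ (b i) (fderiv ℝ W y (b i))
      = volDensity (fderiv ℝ ψ y) * f y := by
    intro y hy
    have hA : HasFDerivAt (fderiv ℝ ψ) (fderiv ℝ (fderiv ℝ ψ) y) y :=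
      ((hA1 y hy).differentiableAt (by simp)).hasFDerivAt
    have hs : IsSymmSndFDerivAt ℝ ψ y :=
      (hψat y hy).isSymmSndFDerivAt (by simpa using ENat.LEInfty.out)
    have hw : HasFDerivAt (fun z => ψ z - c) (fderiv ℝ ψ y) y :=
      ((hψat y hy).differentiableAt (by simp)).hasFDerivAt.sub_const c
    have hgd : HasFDerivAt g (fderiv ℝ g y) y :=
      ((hg.contDiffAt (hU.mem_nhds hy)).differentiableAt (by simp)).hasFDerivAt
    obtain ⟨W', hW', hsum⟩ := divergence_tangentPart b hA hs hw
      (by filter_upwards [hU.mem_nhds hy] with z hz using hinj z hz) hgd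
    rw [hf y hy, ← hsum, (hWeq y hy).fderiv_eq, hW'.fderiv]
  have hdiv0 : ∀ y, y ∉ U → ∑ i, inner ℝ (b i) (fderiv ℝ W y (b i)) = 0 := by
    intro y hy
    rw [(hWeq0 y hy).fderiv_eq]
    simp
  have hind : (fun y => ∑ i, inner ℝ (b i) (fderiv ℝ W y (b i)))
      = U.indicator fun y => volDensity (fderiv ℝ ψ y) * f y := by
    funext y
    by_cases hy : y ∈ U
    · rw [Set.indicator_of_mem hy, hdiv y hy]
    · rw [Set.indicator_of_notMem hy, hdiv0 y hy]
  refine ⟨?_, ?_, ?_⟩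
  · have h1 : ContinuousOn (fun y => volDensity (fderiv ℝ ψ y)) U := fun y hy =>
      (contDiffAt_volDensity (hA1 y hy) (hinj y hy)).continuousAt.continuousWithinAt
    refine (hcont.continuousOn.div h1 fun y hy => (volDensity_pos (hinj y hy)).ne').congr ?_
    intro y hy
    have := (volDensity_pos (hinj y hy)).ne'
    simp only [Pi.div_apply]
    rw [hdiv y hy]
    field_simp
  · rw [hind] at hint
    rwa [integrable_indicator_iff hU.measurableSet] at hint
  · rw [hind] at hzero
    rwa [integral_indicator hU.measurableSet] at hzero

end FlatIntegral

/-! ### Tangent vectors and metric in a chart -/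

section Coordinates

open ContinuousLinearMap

variable {n N : ℕ} {M : Type*} [TopologicalSpace M] [ChartedSpace (EuclideanSpace ℝ (Fin n)) M]
  [IsManifold (𝓡 n) ∞ M]

theorem contMDiffAt_extChartAt_symm (p : M) {y : EuclideanSpace ℝ (Fin n)}
    (hy : y ∈ (extChartAt (𝓡 n) p).target) :
    ContMDiffAt 𝓘(ℝ, EuclideanSpace ℝ (Fin n)) (𝓡 n) ∞ (extChartAt (𝓡 n) p).symm y :=
  (contMDiffOn_extChartAt_symm p).contMDiffAt ((isOpen_extChartAt_target p).mem_nhds hy)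

theorem contDiffOn_comp_extChartAt_symm {G : Type*} [NormedAddCommGroup G] [NormedSpace ℝ G]
    {f : M → G} (hf : ContMDiff (𝓡 n) 𝓘(ℝ, G) ∞ f) (p : M) :
    ContDiffOn ℝ ∞ (f ∘ (extChartAt (𝓡 n) p).symm) (extChartAt (𝓡 n) p).target := fun y hy =>
  ((hf _).comp y (contMDiffAt_extChartAt_symm p hy)).contDiffAt.contDiffWithinAt

theorem mfderiv_extChartAt_apply_symm (p : M) {y : EuclideanSpace ℝ (Fin n)}
    (hy : y ∈ (extChartAt (𝓡 n) p).target) (v : EuclideanSpace ℝ (Fin n)) :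
    (mfderiv (𝓡 n) 𝓘(ℝ, EuclideanSpace ℝ (Fin n)) (extChartAt (𝓡 n) p)
      ((extChartAt (𝓡 n) p).symm y)
      (mfderiv 𝓘(ℝ, EuclideanSpace ℝ (Fin n)) (𝓡 n) (extChartAt (𝓡 n) p).symm y v) :
      EuclideanSpace ℝ (Fin n)) = v := by
  have : IsManifold (𝓡 n) 1 M := IsManifold.of_le (n := ∞) (by simp)
  have h := mfderiv_extChartAt_comp_mfderivWithin_extChartAt_symm (I := 𝓡 n) hy
  rw [ModelWithCorners.range_eq_univ, mfderivWithin_univ] at h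
  exact congrArg (fun T => T v) h

theorem mfderiv_extChartAt_symm_apply (p : M) {y : EuclideanSpace ℝ (Fin n)}
    (hy : y ∈ (extChartAt (𝓡 n) p).target)
    (v : TangentSpace (𝓡 n) ((extChartAt (𝓡 n) p).symm y)) :
    mfderiv 𝓘(ℝ, EuclideanSpace ℝ (Fin n)) (𝓡 n) (extChartAt (𝓡 n) p).symm y
      (mfderiv (𝓡 n) 𝓘(ℝ, EuclideanSpace ℝ (Fin n)) (extChartAt (𝓡 n) p)
      ((extChartAt (𝓡 n) p).symm y) v) = v := by
  have : IsManifold (𝓡 n) 1 M := IsManifold.of_le (n := ∞) (by simp)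
  have h := mfderivWithin_extChartAt_symm_comp_mfderiv_extChartAt (I := 𝓡 n) hy
  rw [ModelWithCorners.range_eq_univ, mfderivWithin_univ] at h
  exact congrArg (fun T => T v) h

/-- The components, in the chart centred at `p`, of a tangent vector at the point with
coordinates `y`. The base point is written through `y`, so that no cast between tangent spaces is
needed. -/
def components (p : M) (y : EuclideanSpace ℝ (Fin n)) :
    TangentSpace (𝓡 n) ((extChartAt (𝓡 n) p).symm y) →L[ℝ] EuclideanSpace ℝ (Fin n) :=
  mfderiv (𝓡 n) 𝓘(ℝ, EuclideanSpace ℝ (Fin n)) (extChartAt (𝓡 n) p) ((extChartAt (𝓡 n) p).symm y)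

/-- The tangent vector with given components in the chart centred at `p`. -/
def ofComponents (p : M) (y : EuclideanSpace ℝ (Fin n)) :
    EuclideanSpace ℝ (Fin n) →L[ℝ] TangentSpace (𝓡 n) ((extChartAt (𝓡 n) p).symm y) :=
  mfderiv 𝓘(ℝ, EuclideanSpace ℝ (Fin n)) (𝓡 n) (extChartAt (𝓡 n) p).symm y

theorem components_ofComponents (p : M) {y : EuclideanSpace ℝ (Fin n)}
    (hy : y ∈ (extChartAt (𝓡 n) p).target) (v : EuclideanSpace ℝ (Fin n)) :
    components p y (ofComponents p y v) = v := mfderiv_extChartAt_apply_symm p hy v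

theorem ofComponents_components (p : M) {y : EuclideanSpace ℝ (Fin n)}
    (hy : y ∈ (extChartAt (𝓡 n) p).target)
    (v : TangentSpace (𝓡 n) ((extChartAt (𝓡 n) p).symm y)) :
    ofComponents p y (components p y v) = v := mfderiv_extChartAt_symm_apply p hy v

theorem mfderiv_ofComponents {G : Type*} [NormedAddCommGroup G] [NormedSpace ℝ G] {f : M → G}
    (p : M) {y : EuclideanSpace ℝ (Fin n)} (hy : y ∈ (extChartAt (𝓡 n) p).target)
    (hf : MDifferentiableAt (𝓡 n) 𝓘(ℝ, G) f ((extChartAt (𝓡 n) p).symm y))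
    (v : EuclideanSpace ℝ (Fin n)) :
    (mfderiv (𝓡 n) 𝓘(ℝ, G) f ((extChartAt (𝓡 n) p).symm y) (ofComponents p y v) : G)
      = fderiv ℝ (f ∘ (extChartAt (𝓡 n) p).symm) y v := by
  have h := mfderiv_comp y hf ((contMDiffAt_extChartAt_symm p hy).mdifferentiableAt (by simp))
  rw [mfderiv_eq_fderiv] at h
  exact (congrArg (fun T => T v) h).symm

theorem mfderiv_eq_fderiv_components {G : Type*} [NormedAddCommGroup G] [NormedSpace ℝ G]
    {f : M → G} (p : M) {y : EuclideanSpace ℝ (Fin n)} (hy : y ∈ (extChartAt (𝓡 n) p).target)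
    (hf : MDifferentiableAt (𝓡 n) 𝓘(ℝ, G) f ((extChartAt (𝓡 n) p).symm y))
    (v : TangentSpace (𝓡 n) ((extChartAt (𝓡 n) p).symm y)) :
    (mfderiv (𝓡 n) 𝓘(ℝ, G) f ((extChartAt (𝓡 n) p).symm y) v : G)
      = fderiv ℝ (f ∘ (extChartAt (𝓡 n) p).symm) y (components p y v) := by
  rw [← mfderiv_ofComponents p hy hf, ofComponents_components p hy]

variable [Bundle.RiemannianBundle (fun x : M => TangentSpace (𝓡 n) x)]
  {φ : M → EuclideanSpace ℝ (Fin N)}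

theorem IsIsometricEmbedding.contMDiff (hφ : IsIsometricEmbedding n φ) :
    ContMDiff (𝓡 n) 𝓘(ℝ, EuclideanSpace ℝ (Fin N)) ∞ φ :=
  hφ.isSmoothEmbedding.isImmersion.contMDiff

theorem IsIsometricEmbedding.differential_eq (hφ : IsIsometricEmbedding n φ) (p : M)
    {y : EuclideanSpace ℝ (Fin n)} (hy : y ∈ (extChartAt (𝓡 n) p).target)
    (v : TangentSpace (𝓡 n) ((extChartAt (𝓡 n) p).symm y)) :
    differential n φ ((extChartAt (𝓡 n) p).symm y) v
      = fderiv ℝ (φ ∘ (extChartAt (𝓡 n) p).symm) y (components p y v) :=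
  mfderiv_eq_fderiv_components p hy ((hφ.contMDiff _).mdifferentiableAt (by simp)) v

theorem IsIsometricEmbedding.differential_ofComponents (hφ : IsIsometricEmbedding n φ) (p : M)
    {y : EuclideanSpace ℝ (Fin n)} (hy : y ∈ (extChartAt (𝓡 n) p).target)
    (v : EuclideanSpace ℝ (Fin n)) :
    differential n φ ((extChartAt (𝓡 n) p).symm y) (ofComponents p y v)
      = fderiv ℝ (φ ∘ (extChartAt (𝓡 n) p).symm) y v := by
  rw [hφ.differential_eq p hy, components_ofComponents p hy]

theorem IsIsometricEmbedding.inner_fderiv (hφ : IsIsometricEmbedding n φ) (p : M)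
    {y : EuclideanSpace ℝ (Fin n)} (hy : y ∈ (extChartAt (𝓡 n) p).target)
    (v w : EuclideanSpace ℝ (Fin n)) :
    inner ℝ (fderiv ℝ (φ ∘ (extChartAt (𝓡 n) p).symm) y v)
        (fderiv ℝ (φ ∘ (extChartAt (𝓡 n) p).symm) y w)
      = inner ℝ (ofComponents p y v) (ofComponents p y w) := by
  rw [← hφ.differential_ofComponents p hy, ← hφ.differential_ofComponents p hy,
    hφ.inner_differential]

theorem IsIsometricEmbedding.inner_eq (hφ : IsIsometricEmbedding n φ) (p : M)
    {y : EuclideanSpace ℝ (Fin n)} (hy : y ∈ (extChartAt (𝓡 n) p).target)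
    (v w : TangentSpace (𝓡 n) ((extChartAt (𝓡 n) p).symm y)) :
    inner ℝ v w = inner ℝ (fderiv ℝ (φ ∘ (extChartAt (𝓡 n) p).symm) y (components p y v))
        (fderiv ℝ (φ ∘ (extChartAt (𝓡 n) p).symm) y (components p y w)) := by
  rw [hφ.inner_fderiv p hy, ofComponents_components p hy, ofComponents_components p hy]

theorem IsIsometricEmbedding.injective_fderiv (hφ : IsIsometricEmbedding n φ) (p : M)
    {y : EuclideanSpace ℝ (Fin n)} (hy : y ∈ (extChartAt (𝓡 n) p).target) :
    Function.Injective (fderiv ℝ (φ ∘ (extChartAt (𝓡 n) p).symm) y) := by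
  rw [injective_iff_map_eq_zero]
  intro v hv
  have h : inner ℝ (ofComponents p y v) (ofComponents p y v) = 0 := by
    rw [← hφ.inner_fderiv p hy, hv, inner_zero_left]
  rw [← components_ofComponents p hy v, inner_self_eq_zero.1 h, map_zero]

theorem IsIsometricEmbedding.sqrt_det_gram (hφ : IsIsometricEmbedding n φ) (p : M)
    {y : EuclideanSpace ℝ (Fin n)} (hy : y ∈ (extChartAt (𝓡 n) p).target) :
    √(gram n p y).det = volDensity (fderiv ℝ (φ ∘ (extChartAt (𝓡 n) p).symm) y) := by
  rw [volDensity, det_gramOp (EuclideanSpace.basisFun (Fin n) ℝ)]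
  congr 2
  ext i j
  rw [Matrix.gram_apply, hφ.inner_fderiv p hy, EuclideanSpace.basisFun_apply,
    EuclideanSpace.basisFun_apply]
  rfl

theorem inner_riemannianGradient (f : M → ℝ) (x : M) (v : TangentSpace (𝓡 n) x) :
    inner ℝ (riemannianGradient n f x) v = (mfderiv (𝓡 n) 𝓘(ℝ, ℝ) f x v : ℝ) := by
  rw [riemannianGradient]
  exact InnerProductSpace.toDual_symm_apply

theorem IsIsometricEmbedding.inner_fderiv_gradient (hφ : IsIsometricEmbedding n φ) (p : M)
    {y : EuclideanSpace ℝ (Fin n)} (hy : y ∈ (extChartAt (𝓡 n) p).target) {f : M → ℝ}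
    (hf : MDifferentiableAt (𝓡 n) 𝓘(ℝ, ℝ) f ((extChartAt (𝓡 n) p).symm y))
    (v : EuclideanSpace ℝ (Fin n)) :
    inner ℝ (fderiv ℝ (φ ∘ (extChartAt (𝓡 n) p).symm) y
        (components p y (riemannianGradient n f ((extChartAt (𝓡 n) p).symm y))))
        (fderiv ℝ (φ ∘ (extChartAt (𝓡 n) p).symm) y v)
      = fderiv ℝ (f ∘ (extChartAt (𝓡 n) p).symm) y v := by
  rw [hφ.inner_fderiv p hy, ofComponents_components p hy, inner_riemannianGradient,
    mfderiv_ofComponents p hy hf]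

end Coordinates

/-! ### The mean curvature vector in a chart -/

section Curvature

open ContinuousLinearMap

/-- The chain rule for second derivatives. -/
theorem fderiv_fderiv_comp {E E' F : Type*} [NormedAddCommGroup E] [NormedSpace ℝ E]
    [NormedAddCommGroup E'] [NormedSpace ℝ E'] [NormedAddCommGroup F] [NormedSpace ℝ F]
    {ψ : E' → F} {τ : E → E'} {y : E} (hψ : ContDiffAt ℝ 2 ψ (τ y)) (hτ : ContDiffAt ℝ 2 τ y)
    (u v : E) :
    fderiv ℝ (fderiv ℝ (ψ ∘ τ)) y u v
      = fderiv ℝ (fderiv ℝ ψ) (τ y) (fderiv ℝ τ y u) (fderiv ℝ τ y v)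
        + fderiv ℝ ψ (τ y) (fderiv ℝ (fderiv ℝ τ) y u v) := by
  have hev : fderiv ℝ (ψ ∘ τ) =ᶠ[𝓝 y] fun z => (fderiv ℝ ψ (τ z)) ∘L (fderiv ℝ τ z) := by
    have h1 : ∀ᶠ z in 𝓝 y, ContDiffAt ℝ 2 ψ (τ z) :=
      hτ.continuousAt.eventually (hψ.eventually (by simp))
    filter_upwards [h1, hτ.eventually (by simp)] with z hz hz'
    exact fderiv_comp z (hz.differentiableAt (by simp)) (hz'.differentiableAt (by simp))
  have hψ' : HasFDerivAt (fderiv ℝ ψ) (fderiv ℝ (fderiv ℝ ψ) (τ y)) (τ y) :=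
    ((hψ.fderiv_right (m := 1) (by norm_num)).differentiableAt (by simp)).hasFDerivAt
  have hτ' : HasFDerivAt (fderiv ℝ τ) (fderiv ℝ (fderiv ℝ τ) y) y :=
    ((hτ.fderiv_right (m := 1) (by norm_num)).differentiableAt (by simp)).hasFDerivAt
  have hτ1 : HasFDerivAt τ (fderiv ℝ τ y) y := (hτ.differentiableAt (by simp)).hasFDerivAt
  have h : HasFDerivAt (fun z => (fderiv ℝ ψ (τ z)) ∘L (fderiv ℝ τ z)) _ y :=
    (HasFDerivAt.comp (g := fderiv ℝ ψ) y hψ' hτ1).clm_comp hτ'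
  rw [hev.fderiv_eq, h.fderiv]
  simp [add_comm]

variable {n N : ℕ} {M : Type*} [TopologicalSpace M] [ChartedSpace (EuclideanSpace ℝ (Fin n)) M]
  [IsManifold (𝓡 n) ∞ M] [Bundle.RiemannianBundle (fun x : M => TangentSpace (𝓡 n) x)]
  {φ : M → EuclideanSpace ℝ (Fin N)}

theorem IsIsometricEmbedding.range_differential (hφ : IsIsometricEmbedding n φ) (p : M)
    {y : EuclideanSpace ℝ (Fin n)} (hy : y ∈ (extChartAt (𝓡 n) p).target) :
    LinearMap.range (differential n φ ((extChartAt (𝓡 n) p).symm y)).toLinearMap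
      = LinearMap.range (fderiv ℝ (φ ∘ (extChartAt (𝓡 n) p).symm) y).toLinearMap := by
  ext z
  constructor
  · rintro ⟨v, rfl⟩
    exact ⟨components p y v, (hφ.differential_eq p hy v).symm⟩
  · rintro ⟨v, rfl⟩
    exact ⟨ofComponents p y v, hφ.differential_ofComponents p hy v⟩

/-- The second fundamental form may be computed in any chart: a change of coordinates alters the
second derivative of `φ` by a tangential vector only. -/
theorem IsIsometricEmbedding.secondFundamentalForm_eq (hφ : IsIsometricEmbedding n φ) (p : M)
    {y : EuclideanSpace ℝ (Fin n)} (hy : y ∈ (extChartAt (𝓡 n) p).target)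
    (v w : TangentSpace (𝓡 n) ((extChartAt (𝓡 n) p).symm y)) :
    secondFundamentalForm n φ ((extChartAt (𝓡 n) p).symm y) v w
      = (LinearMap.range
          (fderiv ℝ (φ ∘ (extChartAt (𝓡 n) p).symm) y).toLinearMap)ᗮ.starProjection
        (fderiv ℝ (fderiv ℝ (φ ∘ (extChartAt (𝓡 n) p).symm)) y
          (components p y v) (components p y w)) := by
  have hI : IsManifold (𝓡 n) 1 M := IsManifold.of_le (n := ∞) (by simp)
  revert v w
  set x := (extChartAt (𝓡 n) p).symm y with hx
  set ψ := φ ∘ (extChartAt (𝓡 n) p).symm with hψ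
  set ψ' := φ ∘ (extChartAt (𝓡 n) x).symm with hψ'
  set τ := extChartAt (𝓡 n) x ∘ (extChartAt (𝓡 n) p).symm with hτ
  have hτy : τ y = extChartAt (𝓡 n) x x := rfl
  have hxt : τ y ∈ (extChartAt (𝓡 n) x).target := mem_extChartAt_target x
  have hτM : ContMDiffAt 𝓘(ℝ, EuclideanSpace ℝ (Fin n)) 𝓘(ℝ, EuclideanSpace ℝ (Fin n)) ∞ τ y :=
    (contMDiffAt_extChartAt (I := 𝓡 n) (x := x)).comp y (contMDiffAt_extChartAt_symm p hy)
  have hτc : ContDiffAt ℝ 2 τ y := hτM.contDiffAt.of_le (by simpa using ENat.LEInfty.out)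
  have hψ'c : ContDiffAt ℝ 2 ψ' (τ y) :=
    ((contDiffOn_comp_extChartAt_symm hφ.contMDiff x).contDiffAt
      ((isOpen_extChartAt_target x).mem_nhds hxt)).of_le (by simpa using ENat.LEInfty.out)
  have hev : ψ =ᶠ[𝓝 y] ψ' ∘ τ := by
    have h1 : ∀ᶠ z in 𝓝 y, (extChartAt (𝓡 n) p).symm z ∈ (extChartAt (𝓡 n) x).source :=
      (contMDiffAt_extChartAt_symm p hy).continuousAt.eventually (extChartAt_source_mem_nhds x)
    filter_upwards [h1] with z hz
    simp only [hψ, hψ', hτ, Function.comp_apply]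
    rw [(extChartAt (𝓡 n) x).left_inv hz]
  intro v w
  have hD : ∀ u, fderiv ℝ τ y (components p y u) = mfderiv (𝓡 n) 𝓘(ℝ, EuclideanSpace ℝ (Fin n))
      (extChartAt (𝓡 n) x) x u := fun u =>
    (mfderiv_eq_fderiv_components p hy
      ((contMDiffAt_extChartAt (I := 𝓡 n) (x := x) (n := 1)).mdifferentiableAt (by simp)) u).symm
  have hsec : fderiv ℝ (fderiv ℝ ψ) y (components p y v) (components p y w)
      = fderiv ℝ (fderiv ℝ ψ') (τ y) (fderiv ℝ τ y (components p y v))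
          (fderiv ℝ τ y (components p y w))
        + fderiv ℝ ψ' (τ y) (fderiv ℝ (fderiv ℝ τ) y (components p y v) (components p y w)) := by
    rw [hev.fderiv.fderiv_eq, fderiv_fderiv_comp hψ'c hτc]
  have hrange : LinearMap.range (differential n φ x).toLinearMap
      = LinearMap.range (fderiv ℝ ψ' (τ y)).toLinearMap := by
    have h := hφ.range_differential x hxt
    have hxx : (extChartAt (𝓡 n) x).symm (τ y) = x := (extChartAt (𝓡 n) x).left_inv
      (mem_extChartAt_source x)
    rwa [hxx] at h
  have hz : (LinearMap.range (differential n φ x).toLinearMap)ᗮ.starProjection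
      (fderiv ℝ ψ' (τ y) (fderiv ℝ (fderiv ℝ τ) y (components p y v) (components p y w))) = 0 := by
    rw [Submodule.starProjection_apply_eq_zero_iff]
    exact Submodule.le_orthogonal_orthogonal _ (hrange ▸ ⟨_, rfl⟩)
  have hproj : (LinearMap.range (fderiv ℝ ψ y).toLinearMap)ᗮ.starProjection
      = (LinearMap.range (differential n φ x).toLinearMap)ᗮ.starProjection := by
    have hcongr : ∀ {K K' : Submodule ℝ (EuclideanSpace ℝ (Fin N))}, K = K' →
        Kᗮ.starProjection = K'ᗮ.starProjection := by
      rintro K _ rfl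
      rfl
    exact hcongr (hφ.range_differential p hy).symm
  rw [hsec, hproj, map_add, hz, add_zero, hD, hD]
  rfl

/-- The mean curvature vector in coordinates. -/
theorem IsIsometricEmbedding.meanCurvatureVector_eq (hφ : IsIsometricEmbedding n φ) (p : M)
    {y : EuclideanSpace ℝ (Fin n)} (hy : y ∈ (extChartAt (𝓡 n) p).target) :
    meanCurvatureVector n φ ((extChartAt (𝓡 n) p).symm y)
      = (LinearMap.range
          (fderiv ℝ (φ ∘ (extChartAt (𝓡 n) p).symm) y).toLinearMap)ᗮ.starProjection
        (metricTrace (EuclideanSpace.basisFun (Fin n) ℝ)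
          (fderiv ℝ (φ ∘ (extChartAt (𝓡 n) p).symm) y)
          (fderiv ℝ (fderiv ℝ (φ ∘ (extChartAt (𝓡 n) p).symm)) y)) := by
  set o := stdOrthonormalBasis ℝ (TangentSpace (𝓡 n) ((extChartAt (𝓡 n) p).symm y)) with ho
  rw [metricTrace_eq_sum _ (hφ.injective_fderiv p hy) _ (fun k => components p y (o k)), map_sum,
    meanCurvatureVector]
  · exact Finset.sum_congr rfl fun k _ => hφ.secondFundamentalForm_eq p hy _ _
  · intro v
    have h := congrArg (components p y) (o.sum_repr' (ofComponents p y v))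
    rw [components_ofComponents p hy, map_sum] at h
    rw [← h]
    refine Finset.sum_congr rfl fun k _ => ?_
    rw [map_smul, h, hφ.inner_eq p hy, components_ofComponents p hy]

/-- Pairing `w` with a normal component is pairing with the normal component of `w`. -/
theorem inner_starProjection_orthogonal_range {E F : Type*} [NormedAddCommGroup E]
    [InnerProductSpace ℝ E] [FiniteDimensional ℝ E] [CompleteSpace E] [NormedAddCommGroup F]
    [InnerProductSpace ℝ F] [CompleteSpace F] {A : E →L[ℝ] F} (hA : Function.Injective A) (h w : F) :
    inner ℝ w ((LinearMap.range A.toLinearMap)ᗮ.starProjection h)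
      = inner ℝ h (w - A (tangentPart A w)) := by
  have h1 : (LinearMap.range A.toLinearMap)ᗮ.starProjection w = w - A (tangentPart A w) := by
    refine Submodule.eq_starProjection_of_mem_orthogonal
      (K := (LinearMap.range A.toLinearMap)ᗮ) ?_ ?_
    · rintro _ ⟨v, rfl⟩
      change inner ℝ (A v) (w - A (tangentPart A w)) = 0
      rw [inner_sub_right, real_inner_comm, real_inner_comm _ (A v), inner_tangentPart hA, sub_self]
    · rw [sub_sub_cancel]
      exact Submodule.le_orthogonal_orthogonal _ ⟨_, rfl⟩
  rw [← h1, ← Submodule.inner_starProjection_left_eq_right, real_inner_comm]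

end Curvature

/-! ### The Riemannian volume in a chart -/

section Volume

open ContinuousLinearMap

theorem det_adjoint {E : Type*} [NormedAddCommGroup E] [InnerProductSpace ℝ E]
    [FiniteDimensional ℝ E] [CompleteSpace E] (T : E →L[ℝ] E) : (adjoint T).det = T.det := by
  let b := stdOrthonormalBasis ℝ E
  rw [ContinuousLinearMap.det, ContinuousLinearMap.det, ← LinearMap.det_toMatrix b.toBasis,
    ← LinearMap.det_toMatrix b.toBasis, ← Matrix.det_transpose]
  congr 1
  ext i j
  simp only [Matrix.transpose_apply, LinearMap.toMatrix_apply, OrthonormalBasis.coe_toBasis,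
    OrthonormalBasis.coe_toBasis_repr_apply, OrthonormalBasis.repr_apply_apply]
  change inner ℝ (b j) (adjoint T (b i)) = inner ℝ (b i) (T (b j))
  rw [adjoint_inner_right, real_inner_comm]

theorem volDensity_comp {E F : Type*} [NormedAddCommGroup E] [InnerProductSpace ℝ E]
    [FiniteDimensional ℝ E] [CompleteSpace E] [NormedAddCommGroup F] [InnerProductSpace ℝ F]
    [CompleteSpace F] (A : E →L[ℝ] F) (T : E →L[ℝ] E) :
    volDensity (A ∘L T) = |T.det| * volDensity A := by
  have h : gramOp (A ∘L T) = adjoint T * (gramOp A * T) := by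
    rw [gramOp, adjoint_comp]
    rfl
  rw [volDensity, h, ContinuousLinearMap.det, toLinearMap_mul, toLinearMap_mul, map_mul, map_mul]
  change √((adjoint T).det * ((gramOp A).det * T.det)) = |T.det| * √((gramOp A).det)
  rw [det_adjoint, mul_comm (gramOp A).det, ← mul_assoc, Real.sqrt_mul (mul_self_nonneg _),
    Real.sqrt_mul_self_eq_abs]

variable {n N : ℕ} {M : Type*} [TopologicalSpace M] [ChartedSpace (EuclideanSpace ℝ (Fin n)) M]
  [IsManifold (𝓡 n) ∞ M] [Bundle.RiemannianBundle (fun x : M => TangentSpace (𝓡 n) x)]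
  {φ : M → EuclideanSpace ℝ (Fin N)} [MeasurableSpace M] [BorelSpace M]

theorem aemeasurable_extChartAt_symm (p : M) : AEMeasurable (extChartAt (𝓡 n) p).symm
    (volume.restrict (extChartAt (𝓡 n) p).target) :=
  (continuousOn_extChartAt_symm p).aemeasurable (isOpen_extChartAt_target p).measurableSet

theorem IsIsometricEmbedding.continuousOn_volDensity (hφ : IsIsometricEmbedding n φ) (p : M) :
    ContinuousOn (fun y => volDensity (fderiv ℝ (φ ∘ (extChartAt (𝓡 n) p).symm) y))
      (extChartAt (𝓡 n) p).target := fun y hy =>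
  (contDiffAt_volDensity
    (((contDiffOn_comp_extChartAt_symm hφ.contMDiff p).contDiffAt
      ((isOpen_extChartAt_target p).mem_nhds hy)).fderiv_right (m := 1) (by norm_cast))
    (hφ.injective_fderiv p hy)).continuousAt.continuousWithinAt

theorem IsIsometricEmbedding.chartMeasure_eq (hφ : IsIsometricEmbedding n φ) (p : M) :
    chartMeasure n p = ((volume.restrict (extChartAt (𝓡 n) p).target).withDensity fun y =>
      ENNReal.ofReal (volDensity (fderiv ℝ (φ ∘ (extChartAt (𝓡 n) p).symm) y))).map
        (extChartAt (𝓡 n) p).symm := by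
  rw [chartMeasure]
  congr 1
  refine withDensity_congr_ae ?_
  filter_upwards [ae_restrict_mem (isOpen_extChartAt_target p).measurableSet] with y hy
  rw [hφ.sqrt_det_gram p hy]

theorem IsIsometricEmbedding.chartMeasure_apply (hφ : IsIsometricEmbedding n φ) (p : M)
    {s : Set M} (hs : MeasurableSet s) :
    chartMeasure n p s = ∫⁻ y in (extChartAt (𝓡 n) p).target ∩ (extChartAt (𝓡 n) p).symm ⁻¹' s,
      ENNReal.ofReal (volDensity (fderiv ℝ (φ ∘ (extChartAt (𝓡 n) p).symm) y)) := by
  rw [hφ.chartMeasure_eq, Measure.map_apply_of_aemeasurable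
    ((aemeasurable_extChartAt_symm p).mono_ac (withDensity_absolutelyContinuous _ _)) hs,
    withDensity_apply', Measure.restrict_restrict' (isOpen_extChartAt_target p).measurableSet,
    Set.inter_comm]

theorem measurableSet_target_inter_preimage (p : M) {s : Set M} (hs : MeasurableSet s) :
    MeasurableSet ((extChartAt (𝓡 n) p).target ∩ (extChartAt (𝓡 n) p).symm ⁻¹' s) := by
  have h := (continuousOn_iff_continuous_domRestrict.1
    (continuousOn_extChartAt_symm (I := 𝓡 n) p)).measurable hs
  have := MeasurableSet.subtype_image (isOpen_extChartAt_target (I := 𝓡 n) p).measurableSet h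
  convert this using 1
  ext y
  simp [Set.domRestrict, and_comm]

/-- Two chart measures agree on the overlap of the chart domains, by the change of variables
formula. -/
theorem IsIsometricEmbedding.chartMeasure_eq_of_subset (hφ : IsIsometricEmbedding n φ) (p q : M)
    {s : Set M} (hs : MeasurableSet s) (hp : s ⊆ (extChartAt (𝓡 n) p).source)
    (hq : s ⊆ (extChartAt (𝓡 n) q).source) : chartMeasure n p s = chartMeasure n q s := by
  set τ := extChartAt (𝓡 n) p ∘ (extChartAt (𝓡 n) q).symm with hτ
  set Bq := (extChartAt (𝓡 n) q).target ∩ (extChartAt (𝓡 n) q).symm ⁻¹' s with hBq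
  have himage : (extChartAt (𝓡 n) p).target ∩ (extChartAt (𝓡 n) p).symm ⁻¹' s = τ '' Bq := by
    ext y
    constructor
    · rintro ⟨hy, hys⟩
      refine ⟨extChartAt (𝓡 n) q ((extChartAt (𝓡 n) p).symm y),
        ⟨(extChartAt (𝓡 n) q).map_source (hq hys), ?_⟩, ?_⟩
      · rwa [Set.mem_preimage, (extChartAt (𝓡 n) q).left_inv (hq hys)]
      · simp only [hτ, Function.comp_apply]
        rw [(extChartAt (𝓡 n) q).left_inv (hq hys), (extChartAt (𝓡 n) p).right_inv hy]
    · rintro ⟨z, ⟨hz, hzs⟩, rfl⟩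
      refine ⟨(extChartAt (𝓡 n) p).map_source (hp hzs), ?_⟩
      simp only [hτ, Set.mem_preimage, Function.comp_apply]
      rwa [(extChartAt (𝓡 n) p).left_inv (hp hzs)]
  have hinj : Set.InjOn τ Bq := by
    rintro z ⟨hz, hzs⟩ z' ⟨hz', hzs'⟩ h
    exact (extChartAt (𝓡 n) q).symm.injOn hz hz' ((extChartAt (𝓡 n) p).injOn (hp hzs) (hp hzs') h)
  have hτc : ∀ y ∈ Bq, ContDiffAt ℝ ∞ τ y := by
    rintro y ⟨hy, hys⟩
    have h1 : ContMDiffAt (𝓡 n) 𝓘(ℝ, EuclideanSpace ℝ (Fin n)) ∞ (extChartAt (𝓡 n) p)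
        ((extChartAt (𝓡 n) q).symm y) :=
      contMDiffAt_extChartAt' (by simpa using hp hys)
    exact (h1.comp y (contMDiffAt_extChartAt_symm q hy)).contDiffAt
  rw [hφ.chartMeasure_apply p hs, hφ.chartMeasure_apply q hs, himage,
    lintegral_image_eq_lintegral_abs_det_fderiv_mul volume
      (measurableSet_target_inter_preimage q hs)
      (fun y hy => ((hτc y hy).differentiableAt (by simp)).hasFDerivAt.hasFDerivWithinAt) hinj]
  refine setLIntegral_congr_fun (measurableSet_target_inter_preimage q hs) fun y hy => ?_
  have hev : φ ∘ (extChartAt (𝓡 n) q).symm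
      =ᶠ[𝓝 y] (φ ∘ (extChartAt (𝓡 n) p).symm) ∘ τ := by
    have h1 : ∀ᶠ z in 𝓝 y, (extChartAt (𝓡 n) q).symm z ∈ (extChartAt (𝓡 n) p).source :=
      (contMDiffAt_extChartAt_symm q hy.1).continuousAt.eventually
        ((isOpen_extChartAt_source p).mem_nhds (hp hy.2))
    filter_upwards [h1] with z hz
    simp only [hτ, Function.comp_apply]
    rw [(extChartAt (𝓡 n) p).left_inv hz]
  have hτy : τ y ∈ (extChartAt (𝓡 n) p).target := (extChartAt (𝓡 n) p).map_source (hp hy.2)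
  have hd : DifferentiableAt ℝ (φ ∘ (extChartAt (𝓡 n) p).symm) (τ y) :=
    ((contDiffOn_comp_extChartAt_symm hφ.contMDiff p).contDiffAt
      ((isOpen_extChartAt_target p).mem_nhds hτy)).differentiableAt (by simp)
  rw [hev.fderiv_eq, fderiv_comp y hd ((hτc y hy).differentiableAt (by simp)), volDensity_comp,
    ENNReal.ofReal_mul (abs_nonneg _)]

variable [Nonempty M] [SecondCountableTopology M]

/-- On a chart domain the Riemannian volume is the measure of that chart. -/
theorem IsIsometricEmbedding.riemannianVolume_restrict (hφ : IsIsometricEmbedding n φ) (p : M) :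
    (riemannianVolume n M).restrict (extChartAt (𝓡 n) p).source = chartMeasure n p := by
  set D : ℕ → Set M := disjointed
    (fun k => (chartAt (EuclideanSpace ℝ (Fin n)) (chartCenters n M k)).source) with hD
  have hDm : ∀ i, MeasurableSet (D i) := fun i =>
    MeasurableSet.disjointed (fun k => (chartAt _ _).open_source.measurableSet) i
  have hU : ⋃ i, D i = Set.univ := by
    rw [hD, iUnion_disjointed]
    exact (exists_chart_cover n M).choose_spec
  have hsub : ∀ i, D i ⊆ (extChartAt (𝓡 n) (chartCenters n M i)).source := fun i => by
    rw [extChartAt_source]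
    exact disjointed_subset _ i
  have hsrc : MeasurableSet (extChartAt (𝓡 n) p).source :=
    (isOpen_extChartAt_source p).measurableSet
  ext s hs
  have hsm : MeasurableSet (s ∩ (extChartAt (𝓡 n) p).source) := hs.inter hsrc
  rw [Measure.restrict_apply hs, riemannianVolume, Measure.sum_apply _ hsm]
  have h1 : ∀ i, (chartMeasure n (chartCenters n M i)).restrict (D i)
      (s ∩ (extChartAt (𝓡 n) p).source)
      = chartMeasure n p (s ∩ (extChartAt (𝓡 n) p).source ∩ D i) := by
    intro i
    rw [Measure.restrict_apply hsm]
    exact hφ.chartMeasure_eq_of_subset _ p (hsm.inter (hDm i))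
      (Set.inter_subset_right.trans (hsub i)) (Set.inter_subset_left.trans Set.inter_subset_right)
  refine (tsum_congr h1).trans ?_
  rw [← measure_iUnion (fun i j hij => (disjoint_disjointed _ hij).mono
    Set.inter_subset_right Set.inter_subset_right) (fun i => hsm.inter (hDm i)),
    ← Set.inter_iUnion, hU, Set.inter_univ, hφ.chartMeasure_apply p hs, hφ.chartMeasure_apply p hsm]
  congr 2
  ext y
  simp only [Set.mem_inter_iff, Set.mem_preimage]
  exact ⟨fun h => ⟨h.1, h.2.1⟩, fun h => ⟨h.1, h.2, (extChartAt (𝓡 n) p).map_target h.1⟩⟩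

theorem IsIsometricEmbedding.isLocallyFiniteMeasure (hφ : IsIsometricEmbedding n φ) :
    IsLocallyFiniteMeasure (riemannianVolume n M) := by
  refine ⟨fun x => ?_⟩
  obtain ⟨K, hKn, hKsub, hKc⟩ := local_compact_nhds (extChartAt_target_mem_nhds (I := 𝓡 n) x)
  set s := (extChartAt (𝓡 n) x).source ∩ extChartAt (𝓡 n) x ⁻¹' interior K with hs
  have hso : IsOpen s := (continuousOn_extChartAt x).isOpen_inter_preimage
    (isOpen_extChartAt_source x) isOpen_interior
  refine ⟨s, hso.mem_nhds ⟨mem_extChartAt_source x, mem_interior_iff_mem_nhds.2 hKn⟩, ?_⟩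
  have hss : s = s ∩ (extChartAt (𝓡 n) x).source := by
    rw [eq_comm, Set.inter_eq_left]
    exact Set.inter_subset_left
  rw [hss, ← Measure.restrict_apply hso.measurableSet, hφ.riemannianVolume_restrict,
    hφ.chartMeasure_apply x hso.measurableSet]
  have hint : IntegrableOn
      (fun y => volDensity (fderiv ℝ (φ ∘ (extChartAt (𝓡 n) x).symm) y)) K :=
    ((hφ.continuousOn_volDensity x).mono hKsub).integrableOn_compact hKc
  refine lt_of_le_of_lt (lintegral_mono_set ?_) hint.lintegral_lt_top
  rintro y ⟨hy, hys⟩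
  have := interior_subset hys.2
  rwa [(extChartAt (𝓡 n) x).right_inv hy] at this

/-- Continuity of `f` provides the measurability needed for transport to coordinates; the inverse
chart is only almost everywhere measurable, its values off the target being arbitrary. -/
theorem IsIsometricEmbedding.integrableOn_source_iff (hφ : IsIsometricEmbedding n φ) (p : M)
    {f : M → ℝ} (hf : ContinuousOn f (extChartAt (𝓡 n) p).source) :
    IntegrableOn f (extChartAt (𝓡 n) p).source (riemannianVolume n M) ↔
      IntegrableOn (fun y => volDensity (fderiv ℝ (φ ∘ (extChartAt (𝓡 n) p).symm) y)
        * f ((extChartAt (𝓡 n) p).symm y)) (extChartAt (𝓡 n) p).target := by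
  have hm := hf.aestronglyMeasurable (μ := riemannianVolume n M)
    (isOpen_extChartAt_source p).measurableSet
  rw [IntegrableOn, hφ.riemannianVolume_restrict, hφ.chartMeasure_eq] at *
  rw [integrable_map_measure hm
    ((aemeasurable_extChartAt_symm p).mono_ac (withDensity_absolutelyContinuous _ _)),
    integrable_withDensity_iff_integrable_smul₀'
      ((hφ.continuousOn_volDensity p).aemeasurable
        (isOpen_extChartAt_target p).measurableSet).ennreal_ofReal (by simp)]
  simp only [ENNReal.toReal_ofReal (Real.sqrt_nonneg _), volDensity]
  rfl

theorem IsIsometricEmbedding.setIntegral_source (hφ : IsIsometricEmbedding n φ) (p : M)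
    {f : M → ℝ} (hf : ContinuousOn f (extChartAt (𝓡 n) p).source) :
    ∫ x in (extChartAt (𝓡 n) p).source, f x ∂(riemannianVolume n M)
      = ∫ y in (extChartAt (𝓡 n) p).target,
          volDensity (fderiv ℝ (φ ∘ (extChartAt (𝓡 n) p).symm) y)
            * f ((extChartAt (𝓡 n) p).symm y) := by
  have hm := hf.aestronglyMeasurable (μ := riemannianVolume n M)
    (isOpen_extChartAt_source p).measurableSet
  rw [hφ.riemannianVolume_restrict, hφ.chartMeasure_eq] at *
  rw [integral_map
    ((aemeasurable_extChartAt_symm p).mono_ac (withDensity_absolutelyContinuous _ _)) hm,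
    integral_withDensity_eq_integral_toReal_smul₀
      ((hφ.continuousOn_volDensity p).aemeasurable
        (isOpen_extChartAt_target p).measurableSet).ennreal_ofReal (by simp)]
  simp only [ENNReal.toReal_ofReal (Real.sqrt_nonneg _), volDensity]
  rfl

end Volume

/-! ### The first variation formula -/

section FirstVariation

open ContinuousLinearMap

theorem eq_tangentPart {E F : Type*} [NormedAddCommGroup E] [InnerProductSpace ℝ E]
    [FiniteDimensional ℝ E] [CompleteSpace E] [NormedAddCommGroup F] [InnerProductSpace ℝ F]
    [CompleteSpace F] {A : E →L[ℝ] F} (hA : Function.Injective A) {w : F} {z : E}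
    (h : ∀ v, inner ℝ (A z) (A v) = inner ℝ w (A v)) : z = tangentPart A w := by
  have h1 : gramOp A z = adjoint A w := ext_inner_right ℝ fun v => by
    rw [inner_gramOp, adjoint_inner_left, h]
  rw [tangentPart, ← h1, inverse_gramOp_apply hA]

variable {n N : ℕ} {M : Type*} [TopologicalSpace M] [ChartedSpace (EuclideanSpace ℝ (Fin n)) M]
  [IsManifold (𝓡 n) ∞ M] [Bundle.RiemannianBundle (fun x : M => TangentSpace (𝓡 n) x)]
  {φ : M → EuclideanSpace ℝ (Fin N)}

variable (n) in
/-- The tangential part of the position vector `φ - c`, as the gradient of `‖φ - c‖² / 2`. -/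
def positionGradient (φ : M → EuclideanSpace ℝ (Fin N)) (c : EuclideanSpace ℝ (Fin N)) (x : M) :
    TangentSpace (𝓡 n) x :=
  riemannianGradient n (fun z => ‖φ z - c‖ ^ 2 / 2) x

variable (n) in
/-- The integrand of the first variation formula for the field `g • (φ - c)`. -/
def variationIntegrand (φ : M → EuclideanSpace ℝ (Fin N)) (c : EuclideanSpace ℝ (Fin N))
    (g : M → ℝ) (x : M) : ℝ :=
  inner ℝ (riemannianGradient n g x) (positionGradient n φ c x)
    + g x * (n + inner ℝ (φ x - c) (meanCurvatureVector n φ x))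

theorem IsIsometricEmbedding.contMDiff_normSq (hφ : IsIsometricEmbedding n φ)
    (c : EuclideanSpace ℝ (Fin N)) :
    ContMDiff (𝓡 n) 𝓘(ℝ, ℝ) ∞ (fun z => ‖φ z - c‖ ^ 2) := by
  have h : ContDiff ℝ ∞ fun z : EuclideanSpace ℝ (Fin N) => ‖z - c‖ ^ 2 :=
    (contDiff_id.sub contDiff_const).norm_sq ℝ
  exact h.contMDiff.comp hφ.contMDiff

theorem IsIsometricEmbedding.components_positionGradient (hφ : IsIsometricEmbedding n φ)
    (c : EuclideanSpace ℝ (Fin N)) (p : M) {y : EuclideanSpace ℝ (Fin n)}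
    (hy : y ∈ (extChartAt (𝓡 n) p).target) :
    components p y (positionGradient n φ c ((extChartAt (𝓡 n) p).symm y))
      = tangentPart (fderiv ℝ (φ ∘ (extChartAt (𝓡 n) p).symm) y)
          (φ ((extChartAt (𝓡 n) p).symm y) - c) := by
  refine eq_tangentPart (hφ.injective_fderiv p hy) fun v => ?_
  have hm : ContMDiff (𝓡 n) 𝓘(ℝ, ℝ) ∞ (fun z => ‖φ z - c‖ ^ 2 / 2) := by
    have h : ContDiff ℝ ∞ fun z : EuclideanSpace ℝ (Fin N) => ‖z - c‖ ^ 2 / 2 :=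
      ((contDiff_id.sub contDiff_const).norm_sq ℝ).div_const 2
    exact h.contMDiff.comp hφ.contMDiff
  rw [positionGradient, hφ.inner_fderiv_gradient p hy ((hm _).mdifferentiableAt (by simp))]
  have hd : HasFDerivAt (fun z => (φ ∘ (extChartAt (𝓡 n) p).symm) z - c)
      (fderiv ℝ (φ ∘ (extChartAt (𝓡 n) p).symm) y) y :=
    (((contDiffOn_comp_extChartAt_symm hφ.contMDiff p).contDiffAt
      ((isOpen_extChartAt_target p).mem_nhds hy)).differentiableAt (by simp)).hasFDerivAt.sub_const c
  have h2 := (hd.norm_sq.const_mul (1 / 2 : ℝ)).fderiv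
  have h3 : ((fun z => ‖φ z - c‖ ^ 2 / 2) ∘ (extChartAt (𝓡 n) p).symm)
      = fun z => 1 / 2 * ‖(φ ∘ (extChartAt (𝓡 n) p).symm) z - c‖ ^ 2 := by
    funext z
    simp only [Function.comp_apply]
    ring
  rw [h3, h2]
  simp [inner_sub_left]

/-- The integrand of the first variation formula in coordinates, in the form of
`flat_first_variation`. -/
theorem IsIsometricEmbedding.variationIntegrand_symm (hφ : IsIsometricEmbedding n φ)
    (c : EuclideanSpace ℝ (Fin N)) (p : M) {y : EuclideanSpace ℝ (Fin n)}
    (hy : y ∈ (extChartAt (𝓡 n) p).target) {g : M → ℝ}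
    (hg : MDifferentiableAt (𝓡 n) 𝓘(ℝ, ℝ) g ((extChartAt (𝓡 n) p).symm y)) :
    variationIntegrand n φ c g ((extChartAt (𝓡 n) p).symm y)
      = fderiv ℝ (g ∘ (extChartAt (𝓡 n) p).symm) y
          (tangentPart (fderiv ℝ (φ ∘ (extChartAt (𝓡 n) p).symm) y)
            ((φ ∘ (extChartAt (𝓡 n) p).symm) y - c))
        + (g ∘ (extChartAt (𝓡 n) p).symm) y * (Fintype.card (Fin n) +
          inner ℝ (metricTrace (EuclideanSpace.basisFun (Fin n) ℝ)
            (fderiv ℝ (φ ∘ (extChartAt (𝓡 n) p).symm) y)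
            (fderiv ℝ (fderiv ℝ (φ ∘ (extChartAt (𝓡 n) p).symm)) y))
          ((φ ∘ (extChartAt (𝓡 n) p).symm) y - c
            - fderiv ℝ (φ ∘ (extChartAt (𝓡 n) p).symm) y
              (tangentPart (fderiv ℝ (φ ∘ (extChartAt (𝓡 n) p).symm) y)
                ((φ ∘ (extChartAt (𝓡 n) p).symm) y - c)))) := by
  rw [variationIntegrand, inner_riemannianGradient, mfderiv_eq_fderiv_components p hy hg,
    hφ.components_positionGradient c p hy, hφ.meanCurvatureVector_eq p hy,
    inner_starProjection_orthogonal_range (hφ.injective_fderiv p hy), Fintype.card_fin]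
  rfl

theorem variationIntegrand_eq_zero {c : EuclideanSpace ℝ (Fin N)} {g : M → ℝ} {x : M}
    (hx : x ∉ tsupport g) : variationIntegrand n φ c g x = 0 := by
  have h : g =ᶠ[𝓝 x] fun _ => 0 := notMem_tsupport_iff_eventuallyEq.1 hx
  rw [variationIntegrand, h.self_of_nhds, zero_mul, add_zero, inner_riemannianGradient,
    h.mfderiv_eq, mfderiv_const]
  rfl

variable [MeasurableSpace M] [BorelSpace M] [Nonempty M] [SecondCountableTopology M]

/-- The first variation formula for `g` supported in a single chart domain. -/
theorem IsIsometricEmbedding.integral_variationIntegrand_of_subset [T2Space M]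
    (hφ : IsIsometricEmbedding n φ)
    (c : EuclideanSpace ℝ (Fin N)) (p : M) {g : M → ℝ} (hg : ContMDiff (𝓡 n) 𝓘(ℝ, ℝ) ∞ g)
    (hgc : HasCompactSupport g) (hgp : tsupport g ⊆ (extChartAt (𝓡 n) p).source) :
    Integrable (variationIntegrand n φ c g) (riemannianVolume n M) ∧
      ∫ x, variationIntegrand n φ c g x ∂(riemannianVolume n M) = 0 := by
  have hT := isOpen_extChartAt_target (I := 𝓡 n) p
  have hU := isOpen_extChartAt_source (I := 𝓡 n) p
  obtain ⟨hc, hi, h0⟩ := flat_first_variation (EuclideanSpace.basisFun (Fin n) ℝ) hT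
    (K := extChartAt (𝓡 n) p '' tsupport g)
    (hgc.isCompact.image_of_continuousOn ((continuousOn_extChartAt p).mono hgp))
    (by rintro _ ⟨x, hx, rfl⟩; exact (extChartAt (𝓡 n) p).map_source (hgp hx))
    (contDiffOn_comp_extChartAt_symm hφ.contMDiff p)
    (fun y hy => hφ.injective_fderiv p hy)
    ((contDiffOn_comp_extChartAt_symm hg p).of_le (by simp))
    (by
      intro y hy hyK
      by_contra hne
      exact hyK ⟨_, subset_tsupport _ hne, (extChartAt (𝓡 n) p).right_inv hy⟩)
    c
    (f := fun y => variationIntegrand n φ c g ((extChartAt (𝓡 n) p).symm y))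
    (fun y hy => hφ.variationIntegrand_symm c p hy ((hg _).mdifferentiableAt (by simp)))
  have hcU : ContinuousOn (variationIntegrand n φ c g) (extChartAt (𝓡 n) p).source := by
    refine (hc.comp (continuousOn_extChartAt p)
      fun x hx => (extChartAt (𝓡 n) p).map_source hx).congr fun x hx => ?_
    simp only [Function.comp_apply]
    rw [(extChartAt (𝓡 n) p).left_inv hx]
  have hsupp : ∀ x, x ∉ (extChartAt (𝓡 n) p).source → variationIntegrand n φ c g x = 0 :=
    fun x hx => variationIntegrand_eq_zero fun h => hx (hgp h)
  constructor
  · refine (integrableOn_iff_integrable_of_support_subset fun x hx => ?_).1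
      ((hφ.integrableOn_source_iff p hcU).2 hi)
    by_contra h
    exact hx (hsupp x h)
  · rw [← setIntegral_eq_integral_of_forall_compl_eq_zero hsupp, hφ.setIntegral_source p hcU, h0]

/-- The first variation formula `∫ ⟨∇g, (φ - c)ᵀ⟩ + g (n + ⟨φ - c, H⟩) = 0`. -/
theorem IsIsometricEmbedding.integral_variationIntegrand [T2Space M]
    (hφ : IsIsometricEmbedding n φ)
    (c : EuclideanSpace ℝ (Fin N)) {g : M → ℝ} (hg : ContMDiff (𝓡 n) 𝓘(ℝ, ℝ) ∞ g)
    (hgc : HasCompactSupport g) :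
    Integrable (variationIntegrand n φ c g) (riemannianVolume n M) ∧
      ∫ x, variationIntegrand n φ c g x ∂(riemannianVolume n M) = 0 := by
  have : LocallyCompactSpace M := Manifold.locallyCompact_of_finiteDimensional (𝓡 n)
  obtain ⟨ρ, hρ⟩ := SmoothPartitionOfUnity.exists_isSubordinate_chartAt_source (𝓡 n) M
  have hfin : {i | (Function.support (ρ i) ∩ tsupport g).Nonempty}.Finite :=
    ρ.locallyFinite.finite_nonempty_inter_compact hgc.isCompact
  have hsum : g = ∑ i ∈ hfin.toFinset, fun x => ρ i x * g x := by
    funext x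
    rw [Finset.sum_apply, ← Finset.sum_mul]
    by_cases hx : g x = 0
    · rw [hx, mul_zero]
    · have h1 : ∑ i ∈ hfin.toFinset, ρ i x = 1 := by
        rw [← ρ.sum_eq_one (Set.mem_univ x), finsum_eq_sum_of_support_subset]
        intro i hi
        rw [Set.Finite.coe_toFinset]
        exact ⟨x, hi, subset_tsupport _ hx⟩
      rw [h1, one_mul]
  let P : (M → ℝ) → Prop := fun g => ContMDiff (𝓡 n) 𝓘(ℝ, ℝ) ∞ g ∧
    Integrable (variationIntegrand n φ c g) (riemannianVolume n M) ∧
      ∫ x, variationIntegrand n φ c g x ∂(riemannianVolume n M) = 0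
  suffices h : P g from h.2
  rw [hsum]
  refine Finset.sum_induction _ P ?_ ?_ ?_
  · rintro g₁ g₂ ⟨hs₁, hi₁, h₁⟩ ⟨hs₂, hi₂, h₂⟩
    have hadd : variationIntegrand n φ c (g₁ + g₂)
        = variationIntegrand n φ c g₁ + variationIntegrand n φ c g₂ := by
      funext x
      have hgrad : inner ℝ (riemannianGradient n (g₁ + g₂) x) (positionGradient n φ c x)
          = inner ℝ (riemannianGradient n g₁ x) (positionGradient n φ c x)
            + inner ℝ (riemannianGradient n g₂ x) (positionGradient n φ c x) := by
        rw [inner_riemannianGradient, inner_riemannianGradient, inner_riemannianGradient,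
          mfderiv_add ((hs₁ x).mdifferentiableAt (by simp)) ((hs₂ x).mdifferentiableAt (by simp))]
        rfl
      simp only [variationIntegrand, Pi.add_apply, hgrad]
      ring
    refine ⟨hs₁.add hs₂, ?_, ?_⟩
    · rw [hadd]
      exact hi₁.add hi₂
    · rw [hadd]
      simp only [Pi.add_apply]
      rw [integral_add hi₁ hi₂, h₁, h₂, add_zero]
  · have hz : variationIntegrand n φ c (0 : M → ℝ) = 0 := by
      funext x
      exact variationIntegrand_eq_zero (by simp)
    refine ⟨contMDiff_const, ?_, ?_⟩
    · rw [hz]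
      exact integrable_zero _ _ _
    · rw [hz]
      simp
  · intro i _
    have hs : ContMDiff (𝓡 n) 𝓘(ℝ, ℝ) ∞ fun x => ρ i x * g x := (ρ i).contMDiff.mul hg
    refine ⟨hs, hφ.integral_variationIntegrand_of_subset c i hs (hgc.mul_left) ?_⟩
    rw [extChartAt_source]
    exact (tsupport_mul_subset_left).trans (hρ i)

end FirstVariation

/-! ### Barta's pointwise inequality and measurability of gradients -/

section Barta

open ContinuousLinearMap

variable {n N : ℕ} {M : Type*} [TopologicalSpace M] [ChartedSpace (EuclideanSpace ℝ (Fin n)) M]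
  [IsManifold (𝓡 n) ∞ M] [Bundle.RiemannianBundle (fun x : M => TangentSpace (𝓡 n) x)]
  {φ : M → EuclideanSpace ℝ (Fin N)}

theorem inner_riemannianGradient_mul {a b : M → ℝ} {x : M}
    (ha : MDifferentiableAt (𝓡 n) 𝓘(ℝ, ℝ) a x) (hb : MDifferentiableAt (𝓡 n) 𝓘(ℝ, ℝ) b x)
    (v : TangentSpace (𝓡 n) x) :
    inner ℝ (riemannianGradient n (a * b) x) v
      = a x * inner ℝ (riemannianGradient n b x) v + b x * inner ℝ (riemannianGradient n a x) v := by
  rw [inner_riemannianGradient, inner_riemannianGradient, inner_riemannianGradient,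
    (ha.hasMFDerivAt.mul hb.hasMFDerivAt).mfderiv]
  rfl

variable (φ) in
/-- The test function `R² - ‖φ - c‖²` of Barta's method. -/
def bartaFunction (R : ℝ) (c : EuclideanSpace ℝ (Fin N)) (x : M) : ℝ := R ^ 2 - ‖φ x - c‖ ^ 2

theorem IsIsometricEmbedding.contMDiff_bartaFunction (hφ : IsIsometricEmbedding n φ) (R : ℝ)
    (c : EuclideanSpace ℝ (Fin N)) : ContMDiff (𝓡 n) 𝓘(ℝ, ℝ) ∞ (bartaFunction φ R c) :=
  contMDiff_const.sub (hφ.contMDiff_normSq c)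

theorem IsIsometricEmbedding.inner_gradient_bartaFunction (hφ : IsIsometricEmbedding n φ) (R : ℝ)
    (c : EuclideanSpace ℝ (Fin N)) (x : M) (v : TangentSpace (𝓡 n) x) :
    inner ℝ (riemannianGradient n (bartaFunction φ R c) x) v
      = -2 * inner ℝ (positionGradient n φ c x) v := by
  have hm : MDifferentiableAt (𝓡 n) 𝓘(ℝ, ℝ) (fun z => ‖φ z - c‖ ^ 2 / 2) x := by
    have h := (hφ.contMDiff_normSq c).mul (contMDiff_const (c := (1 / 2 : ℝ)))
    convert (h x).mdifferentiableAt (by simp) using 1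
    funext z
    simp [div_eq_mul_inv]
  have h1 := (hasMFDerivAt_const (I := 𝓡 n) (I' := 𝓘(ℝ, ℝ)) (R ^ 2) x).add
    (hm.hasMFDerivAt.const_smul (-2 : ℝ))
  have h2 : bartaFunction φ R c = (fun _ => R ^ 2) + (-2 : ℝ) • fun z => ‖φ z - c‖ ^ 2 / 2 := by
    funext z
    simp only [bartaFunction, Pi.add_apply, Pi.smul_apply, smul_eq_mul]
    ring
  rw [inner_riemannianGradient, positionGradient, inner_riemannianGradient, h2, h1.mfderiv]
  exact zero_add _

theorem bartaFunction_pos {R : ℝ} {c : EuclideanSpace ℝ (Fin N)} {x : M}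
    (hx : φ x ∈ Metric.ball c R) : 0 < bartaFunction φ R c x := by
  have h1 := mem_ball_iff_norm.1 hx
  have h0 := norm_nonneg (φ x - c)
  rw [bartaFunction]
  nlinarith

/-- Barta's inequality, pointwise: the difference of the two sides is
`‖∇f + 2 (f / u) (φ - c)ᵀ‖²` plus terms that are nonnegative because `‖H‖ ≤ h` and `0 < u ≤ R²`. -/
theorem IsIsometricEmbedding.barta_pointwise (hφ : IsIsometricEmbedding n φ) {R h : ℝ}
    {c : EuclideanSpace ℝ (Fin N)} {x : M} (hx : φ x ∈ Metric.ball c R)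
    (hH : ‖meanCurvatureVector n φ x‖ ≤ h) (hRh : R * h ≤ n) {f g : M → ℝ}
    (hf : MDifferentiableAt (𝓡 n) 𝓘(ℝ, ℝ) f x) (hg : MDifferentiableAt (𝓡 n) 𝓘(ℝ, ℝ) g x)
    (hfg : bartaFunction φ R c * g = f * f) :
    2 * ((n - R * h) / R ^ 2) * f x ^ 2
      ≤ ‖riemannianGradient n f x‖ ^ 2 + 2 * variationIntegrand n φ c g x := by
  set u := bartaFunction φ R c with hu
  set Z := positionGradient n φ c x with hZ
  have hux : 0 < u x := bartaFunction_pos hx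
  have hxR := mem_ball_iff_norm.1 hx
  have hRpos : 0 < R := lt_of_le_of_lt (norm_nonneg _) hxR
  have huR : u x ≤ R ^ 2 := by
    rw [hu, bartaFunction]
    linarith [sq_nonneg ‖φ x - c‖]
  have hgx : g x = f x ^ 2 / u x := by
    rw [eq_div_iff hux.ne', mul_comm, pow_two]
    exact congrFun hfg x
  set t := f x / u x with ht
  have hgrad : inner ℝ (riemannianGradient n g x) Z
      = 2 * t * inner ℝ (riemannianGradient n f x) Z + 2 * t ^ 2 * ‖Z‖ ^ 2 := by
    have h1 := inner_riemannianGradient_mul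
      (((hφ.contMDiff_bartaFunction R c) x).mdifferentiableAt (by simp)) hg Z
    rw [← hu, hfg, inner_riemannianGradient_mul hf hf, hu, hφ.inner_gradient_bartaFunction, ← hZ,
      ← hu, real_inner_self_eq_norm_sq, hgx] at h1
    rw [ht]
    field_simp
    field_simp at h1
    linarith
  have hsq := norm_add_sq_real (riemannianGradient n f x) ((2 * t) • Z)
  rw [inner_smul_right, norm_smul, mul_pow, Real.norm_eq_abs, sq_abs] at hsq
  have hsq0 := sq_nonneg ‖riemannianGradient n f x + (2 * t) • Z‖
  have hcurv : n - R * h ≤ n + inner ℝ (φ x - c) (meanCurvatureVector n φ x) := by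
    have h1 := abs_real_inner_le_norm (φ x - c) (meanCurvatureVector n φ x)
    have h2 : ‖φ x - c‖ * ‖meanCurvatureVector n φ x‖ ≤ R * h :=
      mul_le_mul hxR.le hH (norm_nonneg _) hRpos.le
    linarith [neg_abs_le (inner ℝ (φ x - c) (meanCurvatureVector n φ x))]
  have hmain : (n - R * h) / R ^ 2 * f x ^ 2
      ≤ g x * (n + inner ℝ (φ x - c) (meanCurvatureVector n φ x)) := by
    calc (n - R * h) / R ^ 2 * f x ^ 2 = f x ^ 2 / R ^ 2 * (n - R * h) := by ring
      _ ≤ f x ^ 2 / u x * (n - R * h) := by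
        refine mul_le_mul_of_nonneg_right ?_ (by linarith)
        exact div_le_div_of_nonneg_left (sq_nonneg _) hux huR
      _ ≤ _ := by
        rw [hgx]
        exact mul_le_mul_of_nonneg_left hcurv (div_nonneg (sq_nonneg _) hux.le)
  rw [variationIntegrand, hgrad]
  linarith

variable [MeasurableSpace M] [BorelSpace M] [Nonempty M] [SecondCountableTopology M]

theorem aemeasurable_of_chart_cover {β : Type*} [MeasurableSpace β] {f : M → β} {μ : Measure M}
    (h : ∀ p : M, AEMeasurable f (μ.restrict (extChartAt (𝓡 n) p).source)) : AEMeasurable f μ := by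
  have hU : ⋃ i, (extChartAt (𝓡 n) (chartCenters n M i)).source = Set.univ := by
    simp only [extChartAt_source]
    exact (exists_chart_cover n M).choose_spec
  rw [← Measure.restrict_univ (μ := μ), ← hU, aemeasurable_iUnion_iff]
  exact fun i => h _

/-- The norm of a tangent vector, from its components in the chart centred at `p`. -/
theorem IsIsometricEmbedding.norm_eq (hφ : IsIsometricEmbedding n φ) (p : M) {x : M}
    (hx : x ∈ (extChartAt (𝓡 n) p).source) (v : TangentSpace (𝓡 n) x) :
    ‖v‖ = ‖fderiv ℝ (φ ∘ (extChartAt (𝓡 n) p).symm) (extChartAt (𝓡 n) p x)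
      (mfderiv (𝓡 n) 𝓘(ℝ, EuclideanSpace ℝ (Fin n)) (extChartAt (𝓡 n) p) x v)‖ := by
  obtain ⟨y, hy, rfl⟩ : ∃ y ∈ (extChartAt (𝓡 n) p).target, (extChartAt (𝓡 n) p).symm y = x :=
    ⟨_, (extChartAt (𝓡 n) p).map_source hx, (extChartAt (𝓡 n) p).left_inv hx⟩
  rw [(extChartAt (𝓡 n) p).right_inv hy, ← sq_eq_sq₀ (norm_nonneg _) (norm_nonneg _),
    ← real_inner_self_eq_norm_sq, ← real_inner_self_eq_norm_sq, hφ.inner_eq p hy]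
  rfl

theorem IsIsometricEmbedding.continuousOn_fderiv (hφ : IsIsometricEmbedding n φ) (p : M) :
    ContinuousOn (fun x => fderiv ℝ (φ ∘ (extChartAt (𝓡 n) p).symm) (extChartAt (𝓡 n) p x))
      (extChartAt (𝓡 n) p).source :=
  ((contDiffOn_comp_extChartAt_symm hφ.contMDiff p).continuousOn_fderiv_of_isOpen
    (isOpen_extChartAt_target p) (by simp)).comp (continuousOn_extChartAt p)
    fun _ hx => (extChartAt (𝓡 n) p).map_source hx

theorem IsIsometricEmbedding.aemeasurable_enorm (hφ : IsIsometricEmbedding n φ) {μ : Measure M}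
    {X : (x : M) → TangentSpace (𝓡 n) x} (hX : AEMeasurableField n μ X) :
    AEMeasurable (fun x => ‖X x‖ₑ) μ := by
  refine aemeasurable_of_chart_cover (n := n) fun p => ?_
  have hU := (isOpen_extChartAt_source (I := 𝓡 n) p).measurableSet
  have h1 := (hφ.continuousOn_fderiv p).aestronglyMeasurable (μ := μ) hU
  have h2 := hX p
  rw [← extChartAt_source (I := 𝓡 n)] at h2
  have h3 := (isBoundedBilinearMap_apply (𝕜 := ℝ)
    (E := EuclideanSpace ℝ (Fin n)) (F := EuclideanSpace ℝ (Fin N))).continuous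
      |>.comp_aestronglyMeasurable (h1.prodMk h2)
  refine h3.enorm.congr ?_
  filter_upwards [ae_restrict_mem hU] with x hx
  rw [← ofReal_norm, ← ofReal_norm, hφ.norm_eq p hx]

theorem IsIsometricEmbedding.aemeasurableField_gradient (hφ : IsIsometricEmbedding n φ)
    {μ : Measure M} {f : M → ℝ} (hf : ContMDiff (𝓡 n) 𝓘(ℝ, ℝ) ∞ f) :
    AEMeasurableField n μ (riemannianGradient n f) := by
  intro p
  rw [← extChartAt_source (I := 𝓡 n)]
  have hT := isOpen_extChartAt_target (I := 𝓡 n) p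
  refine ContinuousOn.aestronglyMeasurable ?_ (isOpen_extChartAt_source (I := 𝓡 n) p).measurableSet
  have hc : ContinuousOn (fun y => Ring.inverse
      (gramOp (fderiv ℝ (φ ∘ (extChartAt (𝓡 n) p).symm) y))
      ((InnerProductSpace.toDual ℝ (EuclideanSpace ℝ (Fin n))).symm
        (fderiv ℝ (f ∘ (extChartAt (𝓡 n) p).symm) y))) (extChartAt (𝓡 n) p).target := by
    refine ContinuousOn.clm_apply (fun y hy => ?_)
      ((InnerProductSpace.toDual ℝ (EuclideanSpace ℝ (Fin n))).symm.continuous.comp_continuousOn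
        ((contDiffOn_comp_extChartAt_symm hf p).continuousOn_fderiv_of_isOpen hT (by simp)))
    have h1 : ContDiffAt ℝ 1 (fderiv ℝ (φ ∘ (extChartAt (𝓡 n) p).symm)) y :=
      ((contDiffOn_comp_extChartAt_symm hφ.contMDiff p).contDiffAt (hT.mem_nhds hy)).fderiv_right
        (by norm_cast)
    exact (differentiableAt_inverse_gramOp (h1.differentiableAt (by simp)).hasFDerivAt
      (hφ.injective_fderiv p hy)).continuousAt.continuousWithinAt
  refine (hc.comp (continuousOn_extChartAt p)
    fun x hx => (extChartAt (𝓡 n) p).map_source hx).congr fun x hx => ?_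
  obtain ⟨y, hy, rfl⟩ : ∃ y ∈ (extChartAt (𝓡 n) p).target, (extChartAt (𝓡 n) p).symm y = x :=
    ⟨_, (extChartAt (𝓡 n) p).map_source hx, (extChartAt (𝓡 n) p).left_inv hx⟩
  simp only [Function.comp_apply]
  rw [(extChartAt (𝓡 n) p).right_inv hy]
  change components p y (riemannianGradient n f ((extChartAt (𝓡 n) p).symm y)) = _
  rw [← inverse_gramOp_apply (hφ.injective_fderiv p hy) (components p y _)]
  congr 1
  refine ext_inner_right ℝ fun v => ?_
  rw [inner_gramOp, hφ.inner_fderiv_gradient p hy ((hf _).mdifferentiableAt (by simp)),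
    InnerProductSpace.toDual_symm_apply]

theorem AEMeasurableField.sub {μ : Measure M} {X Y : (x : M) → TangentSpace (𝓡 n) x}
    (hX : AEMeasurableField n μ X) (hY : AEMeasurableField n μ Y) :
    AEMeasurableField n μ (fun x => X x - Y x) := by
  intro p
  refine ((hX p).sub (hY p)).congr (Filter.Eventually.of_forall fun x => ?_)
  exact (map_sub (mfderiv (𝓡 n) 𝓘(ℝ, EuclideanSpace ℝ (Fin n)) (extChartAt (𝓡 n) p) x) _ _).symm

end Barta

/-! ### The lower bound for the fundamental tone -/

section Tone

theorem mul_rpow_half_le {κ a b : ℝ≥0∞} (h : κ * a ≤ b) :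
    κ ^ (1 / 2 : ℝ) * a ^ (1 / 2 : ℝ) ≤ b ^ (1 / 2 : ℝ) := by
  rw [← ENNReal.mul_rpow_of_nonneg _ _ (by norm_num)]
  exact ENNReal.rpow_le_rpow h (by norm_num)

/-- Minkowski's inequality in `L²`, for a function dominated by a sum. -/
theorem rpow_half_sq_lintegral_le {α : Type*} [MeasurableSpace α] {μ : Measure α}
    {f a b : α → ℝ≥0∞} (ha : AEMeasurable a μ) (hb : AEMeasurable b μ) (h : ∀ x, f x ≤ a x + b x) :
    (∫⁻ x, f x ^ 2 ∂μ) ^ (1 / 2 : ℝ)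
      ≤ (∫⁻ x, a x ^ 2 ∂μ) ^ (1 / 2 : ℝ) + (∫⁻ x, b x ^ 2 ∂μ) ^ (1 / 2 : ℝ) := by
  have h1 := ENNReal.lintegral_Lp_add_le (p := 2) ha hb (by norm_num)
  simp only [ENNReal.rpow_two, Pi.add_apply] at h1
  refine le_trans (ENNReal.rpow_le_rpow (lintegral_mono fun x => ?_) (by norm_num)) h1
  exact pow_le_pow_left₀ (zero_le) (h x) 2

variable {n N : ℕ} {M : Type*} [TopologicalSpace M] [ChartedSpace (EuclideanSpace ℝ (Fin n)) M]
  [IsManifold (𝓡 n) ∞ M] [Bundle.RiemannianBundle (fun x : M => TangentSpace (𝓡 n) x)]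
  {φ : M → EuclideanSpace ℝ (Fin N)}
  [MeasurableSpace M] [BorelSpace M] [Nonempty M] [SecondCountableTopology M] [T2Space M]

theorem IsIsometricEmbedding.lintegral_sq_lt_top (hφ : IsIsometricEmbedding n φ) {f : M → ℝ}
    (hf : Continuous f) (hfc : HasCompactSupport f) :
    ∫⁻ x, ‖f x‖ₑ ^ 2 ∂(riemannianVolume n M) < ⊤ := by
  have := hφ.isLocallyFiniteMeasure
  have h := ((hf.mul hf).integrable_of_hasCompactSupport (hfc.mul_left)
    (μ := riemannianVolume n M)).hasFiniteIntegral
  simpa [HasFiniteIntegral, enorm_mul, pow_two] using h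

/-- Barta's inequality for test functions. -/
theorem IsIsometricEmbedding.barta_lintegral (hφ : IsIsometricEmbedding n φ) {R h : ℝ}
    {c : EuclideanSpace ℝ (Fin N)} (hball : ∀ x, φ x ∈ Metric.ball c R)
    (hH : ∀ x, ‖meanCurvatureVector n φ x‖ ≤ h) (hRh : R * h ≤ n) {f : M → ℝ}
    (hf : ContMDiff (𝓡 n) 𝓘(ℝ, ℝ) ∞ f) (hfc : HasCompactSupport f) :
    ENNReal.ofReal (2 * ((n - R * h) / R ^ 2)) * ∫⁻ x, ‖f x‖ₑ ^ 2 ∂(riemannianVolume n M)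
      ≤ ∫⁻ x, ‖riemannianGradient n f x‖ₑ ^ 2 ∂(riemannianVolume n M) := by
  set μ := riemannianVolume n M with hμ
  set κ := 2 * ((n - R * h) / R ^ 2) with hκ
  have hκ0 : 0 ≤ κ := by
    have : 0 ≤ n - R * h := by linarith
    positivity
  -- When the right-hand side is finite, the Bochner integral is available.
  rcases eq_or_ne (∫⁻ x, ‖riemannianGradient n f x‖ₑ ^ 2 ∂μ) ⊤ with htop | htop
  · rw [htop]
    exact le_top
  have hlf := hφ.isLocallyFiniteMeasure
  have hu := hφ.contMDiff_bartaFunction R c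
  have hu0 : ∀ x, bartaFunction φ R c x ≠ 0 := fun x => (bartaFunction_pos (hball x)).ne'
  set g : M → ℝ := f * f / bartaFunction φ R c with hg
  have hgs : ContMDiff (𝓡 n) 𝓘(ℝ, ℝ) ∞ g := (hf.mul hf).div₀ hu hu0
  have hgc : HasCompactSupport g := hfc.mono fun x hx => by
    contrapose! hx
    simp only [Function.mem_support, not_not] at hx ⊢
    simp [hg, hx]
  have hug : bartaFunction φ R c * g = f * f := by
    funext x
    simp only [hg, Pi.mul_apply, Pi.div_apply]
    exact mul_div_cancel₀ _ (hu0 x)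
  obtain ⟨hVi, hV0⟩ := hφ.integral_variationIntegrand c hgs hgc
  have hpt : ∀ x, κ * f x ^ 2
      ≤ ‖riemannianGradient n f x‖ ^ 2 + 2 * variationIntegrand n φ c g x := fun x =>
    hφ.barta_pointwise (hball x) (hH x) hRh ((hf x).mdifferentiableAt (by simp))
      ((hgs x).mdifferentiableAt (by simp)) hug
  have hen : ∀ x, ENNReal.ofReal (‖riemannianGradient n f x‖ ^ 2)
      = ‖riemannianGradient n f x‖ₑ ^ 2 := fun x => by
    rw [ENNReal.ofReal_pow (norm_nonneg _), ofReal_norm]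
  have hmeas : AEStronglyMeasurable (fun x => ‖riemannianGradient n f x‖ ^ 2) μ := by
    have h1 := (hφ.aemeasurable_enorm
      (hφ.aemeasurableField_gradient (μ := μ) hf)).ennreal_toReal
    simp only [toReal_enorm] at h1
    exact (h1.pow_const 2).aestronglyMeasurable
  have hGi : Integrable (fun x => ‖riemannianGradient n f x‖ ^ 2) μ := by
    refine ⟨hmeas, ?_⟩
    rw [hasFiniteIntegral_iff_ofReal (Filter.Eventually.of_forall fun x => sq_nonneg _)]
    simp only [hen]
    exact htop.lt_top
  have hfi : Integrable (fun x => f x ^ 2) μ := by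
    simp only [pow_two]
    exact (hf.continuous.mul hf.continuous).integrable_of_hasCompactSupport hfc.mul_left
  have hint : ∫ x, κ * f x ^ 2 ∂μ ≤ ∫ x, ‖riemannianGradient n f x‖ ^ 2 ∂μ := by
    have h1 := integral_mono (hfi.const_mul κ) (hGi.add (hVi.const_mul 2)) hpt
    simp only [Pi.add_apply] at h1
    rwa [integral_add hGi (hVi.const_mul 2), integral_const_mul 2, hV0, mul_zero, add_zero] at h1
  have hfe : ∀ x, ‖f x‖ₑ ^ 2 = ENNReal.ofReal (f x ^ 2) := fun x => by
    rw [← sq_abs, ENNReal.ofReal_pow (abs_nonneg _), ← Real.norm_eq_abs, ofReal_norm]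
  simp only [hfe, ← hen]
  rw [← ofReal_integral_eq_lintegral_ofReal hfi (Filter.Eventually.of_forall fun x => sq_nonneg _),
    ← ofReal_integral_eq_lintegral_ofReal hGi (Filter.Eventually.of_forall fun x => sq_nonneg _),
    ← ENNReal.ofReal_mul hκ0, ← integral_const_mul]
  exact ENNReal.ofReal_le_ofReal hint

/-- An inequality `κ ∫ u² ≤ ∫ |∇u|²` for test functions passes to the completion. -/
theorem IsIsometricEmbedding.le_fundamentalTone (hφ : IsIsometricEmbedding n φ) {κ : ℝ≥0∞}
    (hκ : κ ≠ ⊤) (h : ∀ f : M → ℝ, ContMDiff (𝓡 n) 𝓘(ℝ, ℝ) ∞ f → HasCompactSupport f →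
      κ * ∫⁻ x, ‖f x‖ₑ ^ 2 ∂(riemannianVolume n M)
        ≤ ∫⁻ x, ‖riemannianGradient n f x‖ₑ ^ 2 ∂(riemannianVolume n M)) :
    κ ≤ fundamentalTone n M := by
  refine le_iInf fun f => le_iInf fun X => le_iInf fun hfX => le_iInf fun hf0 => ?_
  set μ := riemannianVolume n M with hμ
  obtain ⟨u, hu, hlim, hlimX⟩ := hfX.exists_approx
  have hfm : AEMeasurable (fun x => ‖f x‖ₑ) μ := hfX.aestronglyMeasurable.enorm
  have hum : ∀ k, AEStronglyMeasurable (u k) μ := fun k =>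
    (hu k).1.continuous.aestronglyMeasurable
  have hdm : ∀ k, AEMeasurable (fun x => ‖u k x - f x‖ₑ) μ := fun k =>
    ((hum k).sub hfX.aestronglyMeasurable).enorm
  have hXm : AEMeasurable (fun x => ‖X x‖ₑ) μ := hφ.aemeasurable_enorm hfX.aemeasurableField
  have hDm : ∀ k, AEMeasurable (fun x => ‖riemannianGradient n (u k) x - X x‖ₑ) μ := fun k =>
    hφ.aemeasurable_enorm ((hφ.aemeasurableField_gradient (hu k).1).sub hfX.aemeasurableField)
  have htri : ∀ k, (∫⁻ x, ‖f x‖ₑ ^ 2 ∂μ) ^ (1 / 2 : ℝ)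
      ≤ (∫⁻ x, ‖u k x‖ₑ ^ 2 ∂μ) ^ (1 / 2 : ℝ)
        + (∫⁻ x, ‖u k x - f x‖ₑ ^ 2 ∂μ) ^ (1 / 2 : ℝ) := fun k =>
    rpow_half_sq_lintegral_le (hum k).enorm (hdm k) fun x => by
      simpa using enorm_sub_le (a := u k x) (b := u k x - f x)
  have htriX : ∀ k, (∫⁻ x, ‖riemannianGradient n (u k) x‖ₑ ^ 2 ∂μ) ^ (1 / 2 : ℝ)
      ≤ (∫⁻ x, ‖X x‖ₑ ^ 2 ∂μ) ^ (1 / 2 : ℝ)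
        + (∫⁻ x, ‖riemannianGradient n (u k) x - X x‖ₑ ^ 2 ∂μ) ^ (1 / 2 : ℝ) := fun k =>
    rpow_half_sq_lintegral_le hXm (hDm k) fun x => by
      simpa using enorm_add_le (X x) (riemannianGradient n (u k) x - X x)
  have hroot : ∀ {v : ℕ → ℝ≥0∞}, Tendsto v atTop (𝓝 0) →
      Tendsto (fun k => v k ^ (1 / 2 : ℝ)) atTop (𝓝 0) := fun {v} hv => by
    have h1 := (ENNReal.continuous_rpow_const (y := (1 / 2 : ℝ))).tendsto 0
    rw [ENNReal.zero_rpow_of_pos (by norm_num)] at h1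
    exact h1.comp hv
  -- A quotient `∞ / ∞` in `ℝ≥0∞` would be `0`, so finiteness of `∫ f²` matters.
  have hffin : ∫⁻ x, ‖f x‖ₑ ^ 2 ∂μ ≠ ⊤ := by
    obtain ⟨k, hk⟩ := ((hroot hlim).eventually (gt_mem_nhds ENNReal.zero_lt_top)).exists
    have h1 := hφ.lintegral_sq_lt_top (hu k).1.continuous (hu k).2
    have h2 := (htri k).trans_lt (ENNReal.add_lt_top.2
      ⟨ENNReal.rpow_lt_top_of_nonneg (by norm_num) h1.ne, hk⟩)
    intro htop
    rw [htop, ENNReal.top_rpow_of_pos (by norm_num)] at h2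
    exact lt_irrefl _ h2
  have hfne : ∫⁻ x, ‖f x‖ₑ ^ 2 ∂μ ≠ 0 := by
    intro h0
    rw [lintegral_eq_zero_iff' (hfm.pow_const 2)] at h0
    refine hf0 ?_
    filter_upwards [h0] with x hx
    simpa using hx
  have hκ' : κ ^ (1 / 2 : ℝ) ≠ ⊤ := ENNReal.rpow_ne_top_of_nonneg (by norm_num) hκ
  have hroots : κ ^ (1 / 2 : ℝ) * (∫⁻ x, ‖f x‖ₑ ^ 2 ∂μ) ^ (1 / 2 : ℝ)
      ≤ (∫⁻ x, ‖X x‖ₑ ^ 2 ∂μ) ^ (1 / 2 : ℝ) := by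
    have hl : Tendsto (fun k => (∫⁻ x, ‖X x‖ₑ ^ 2 ∂μ) ^ (1 / 2 : ℝ)
        + ((∫⁻ x, ‖riemannianGradient n (u k) x - X x‖ₑ ^ 2 ∂μ) ^ (1 / 2 : ℝ)
        + κ ^ (1 / 2 : ℝ) * (∫⁻ x, ‖u k x - f x‖ₑ ^ 2 ∂μ) ^ (1 / 2 : ℝ))) atTop
        (𝓝 ((∫⁻ x, ‖X x‖ₑ ^ 2 ∂μ) ^ (1 / 2 : ℝ) + (0 + κ ^ (1 / 2 : ℝ) * 0))) :=
      tendsto_const_nhds.add ((hroot hlimX).add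
        (ENNReal.Tendsto.const_mul (hroot hlim) (Or.inr hκ')))
    rw [mul_zero, add_zero, add_zero] at hl
    refine ge_of_tendsto' hl fun k => ?_
    calc κ ^ (1 / 2 : ℝ) * (∫⁻ x, ‖f x‖ₑ ^ 2 ∂μ) ^ (1 / 2 : ℝ)
        ≤ κ ^ (1 / 2 : ℝ) * ((∫⁻ x, ‖u k x‖ₑ ^ 2 ∂μ) ^ (1 / 2 : ℝ)
          + (∫⁻ x, ‖u k x - f x‖ₑ ^ 2 ∂μ) ^ (1 / 2 : ℝ)) := mul_le_mul_right (htri k) _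
      _ = κ ^ (1 / 2 : ℝ) * (∫⁻ x, ‖u k x‖ₑ ^ 2 ∂μ) ^ (1 / 2 : ℝ)
          + κ ^ (1 / 2 : ℝ) * (∫⁻ x, ‖u k x - f x‖ₑ ^ 2 ∂μ) ^ (1 / 2 : ℝ) := mul_add _ _ _
      _ ≤ ((∫⁻ x, ‖X x‖ₑ ^ 2 ∂μ) ^ (1 / 2 : ℝ)
          + (∫⁻ x, ‖riemannianGradient n (u k) x - X x‖ₑ ^ 2 ∂μ) ^ (1 / 2 : ℝ))
          + κ ^ (1 / 2 : ℝ) * (∫⁻ x, ‖u k x - f x‖ₑ ^ 2 ∂μ) ^ (1 / 2 : ℝ) :=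
        add_le_add_left ((mul_rpow_half_le (h (u k) (hu k).1 (hu k).2)).trans (htriX k)) _
      _ = _ := add_assoc _ _ _
  rw [← ENNReal.mul_rpow_of_nonneg _ _ (by norm_num),
    ENNReal.rpow_le_rpow_iff (by norm_num)] at hroots
  exact (ENNReal.le_div_iff_mul_le (Or.inl hfne) (Or.inl hffin)).2 hroots

/-- The estimate for a real bound `h` of the mean curvature; it is trivial unless `h < n / R`. -/
theorem IsIsometricEmbedding.sub_le_tone_mul (hφ : IsIsometricEmbedding n φ) {R h : ℝ}
    {c : EuclideanSpace ℝ (Fin N)} (hball : ∀ x, φ x ∈ Metric.ball c R)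
    (hH : ∀ x, ‖meanCurvatureVector n φ x‖ ≤ h) :
    (((n : ℝ) / R - h : ℝ) : EReal) ≤ (fundamentalTone n M : EReal) * ((R / 2 : ℝ) : EReal) := by
  obtain ⟨x₀⟩ : Nonempty M := inferInstance
  have hR : 0 < R := lt_of_le_of_lt (norm_nonneg _) (mem_ball_iff_norm.1 (hball x₀))
  have hR2 : (0 : EReal) ≤ ((R / 2 : ℝ) : EReal) := by
    exact_mod_cast (by positivity : (0 : ℝ) ≤ R / 2)
  rcases le_total ((n : ℝ) / R) h with hle | hle
  · refine le_trans ?_ (mul_nonneg (EReal.coe_ennreal_nonneg _) hR2)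
    exact_mod_cast sub_nonpos.2 hle
  · have hRh : R * h ≤ n := by
      rw [le_div_iff₀ hR] at hle
      linarith
    have hκ0 : 0 ≤ 2 * ((n - R * h) / R ^ 2) := by
      have : 0 ≤ n - R * h := by linarith
      positivity
    have hκ := hφ.le_fundamentalTone ENNReal.ofReal_ne_top
      fun f hf hfc => hφ.barta_lintegral hball hH hRh hf hfc
    have h1 : ((2 * ((n - R * h) / R ^ 2) : ℝ) : EReal) ≤ (fundamentalTone n M : EReal) := by
      have := EReal.coe_ennreal_le_coe_ennreal_iff.2 hκ
      rwa [EReal.coe_ennreal_ofReal, max_eq_left hκ0] at this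
    have h2 : (n : ℝ) / R - h = 2 * ((n - R * h) / R ^ 2) * (R / 2) := by
      field_simp
    rw [h2, EReal.coe_mul]
    exact mul_le_mul_of_nonneg_right h1 hR2

end Tone

end RiemGeom

end

theorem theorem1 {n N : ℕ} {M : Type*} [EMetricSpace M] [CompleteSpace M] [Nonempty M]
    [SecondCountableTopology M] [MeasurableSpace M] [BorelSpace M]
    [ChartedSpace (EuclideanSpace ℝ (Fin n)) M] [IsManifold (𝓡 n) ∞ M]
    [Bundle.RiemannianBundle (fun x : M => TangentSpace (𝓡 n) x)]
    [IsContMDiffRiemannianBundle (𝓡 n) ∞ (EuclideanSpace ℝ (Fin n))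
      (fun x : M => TangentSpace (𝓡 n) x)]
    [IsRiemannianManifold (𝓡 n) M]
    (R : ℝ) (c : EuclideanSpace ℝ (Fin N)) (φ : M → EuclideanSpace ℝ (Fin N))
    (hφ : RiemGeom.IsIsometricEmbedding n φ) (hball : ∀ x, φ x ∈ Metric.ball c R) :
    (((n : ℝ) / R : ℝ) : EReal) - (RiemGeom.fundamentalTone n M : EReal) * ((R / 2 : ℝ) : EReal)
        ≤ ⨆ x : M, ((‖RiemGeom.meanCurvatureVector n φ x‖ : ℝ) : EReal) ∧
    (0 < n → ∀ (H : M → ℝ) (η : M → EuclideanSpace ℝ (Fin N)),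
      (∀ x, ‖η x‖ = 1) →
      (∀ (x : M) (v : TangentSpace (𝓡 n) x), inner ℝ (RiemGeom.differential n φ x v) (η x) = 0) →
      (∀ x, RiemGeom.meanCurvatureVector n φ x = ((n : ℝ) * H x) • η x) →
      ((1 / R : ℝ) : EReal)
          - (RiemGeom.fundamentalTone n M : EReal) * ((R / (2 * n) : ℝ) : EReal)
        ≤ ⨆ x : M, ((|H x| : ℝ) : EReal)) := by
  -- A supremum of nonnegative reals is `⊤` or a real upper bound.
  have hsup : ∀ (F : M → ℝ) (a : ℝ) (b : EReal), (∀ x, 0 ≤ F x) →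
      (∀ h : ℝ, (∀ x, F x ≤ h) → ((a - h : ℝ) : EReal) ≤ b) →
      (a : EReal) - b ≤ ⨆ x, (F x : EReal) := by
    intro F a b hF hab
    rcases eq_or_ne (⨆ x, (F x : EReal)) ⊤ with htop | htop
    · rw [htop]
      exact le_top
    have hbot : (⨆ x, (F x : EReal)) ≠ ⊥ := by
      obtain ⟨x₀⟩ : Nonempty M := inferInstance
      exact ((EReal.bot_lt_coe _).trans_le (le_iSup (fun x => (F x : EReal)) x₀)).ne'
    have hcoe := EReal.coe_toReal htop hbot
    have h1 := hab (⨆ x, (F x : EReal)).toReal fun x => by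
      rw [← EReal.coe_le_coe_iff, hcoe]
      exact le_iSup (fun x => (F x : EReal)) x
    rw [← hcoe]
    refine EReal.sub_le_of_le_add ?_
    have h2 := add_le_add_right h1 (((⨆ x, (F x : EReal)).toReal : ℝ) : EReal)
    rw [← EReal.coe_add, add_sub_cancel] at h2
    exact h2
  refine ⟨hsup _ _ _ (fun x => norm_nonneg _) fun h hh => hφ.sub_le_tone_mul hball hh, ?_⟩
  intro hn H η hη _ hHη
  have hn' : (0 : ℝ) < n := by exact_mod_cast hn
  refine hsup _ _ _ (fun x => abs_nonneg _) fun h hh => ?_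
  have h1 := hφ.sub_le_tone_mul hball (h := n * h) fun x => by
    rw [hHη x, norm_smul, hη x, mul_one, Real.norm_eq_abs, abs_mul, abs_of_pos hn']
    exact mul_le_mul_of_nonneg_left (hh x) hn'.le
  have h0 : (0 : EReal) ≤ ((1 / n : ℝ) : EReal) := by
    exact_mod_cast (by positivity : (0 : ℝ) ≤ 1 / n)
  have h2 := mul_le_mul_of_nonneg_right h1 h0
  rw [mul_assoc, ← EReal.coe_mul, ← EReal.coe_mul] at h2
  have h3 : (1 / R - h : ℝ) = ((n : ℝ) / R - n * h) * (1 / n) := by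
    field_simp
  have h4 : R / (2 * n) = R / 2 * (1 / n) := by
    field_simp
  rw [h3, h4]
  exact h2
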